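/- **Geometry.** Let $h>0$, $0<s<1$, $R>1$. Let $E\subset\mathbb R^3$ be the union of the six edges of the tetrahedron (wedge) $W$ with vertices $(-h,0,\pm1)$, $(h,\pm1,0)$. Let $D_1=\{x=-sh,\ -R\le y\le 0,\ |z|\le R\}$ and $D_2=\{x=sh,\ |y|\le R,\ 0\le z\le R\}$, and let $C_1,C_2$ (the *invisible wires*) be the perimeters of the rectangles $D_1,D_2$. Put $B=\mathbb R^3\setminus(E\cup C_1\cup C_2)$. **The cover.** Call the faces $\{2hy=-(h+x)\}$, $\{2hy=h+x\}$, $\{2hz=h-x\}$, $\{2hz=-(h-x)\}$ of $W$ the front, back, top and bottom face. Take three copies (sheets $1,2,3$) of $B$, cut them along $D_1$, $D_2$ and along the large surface consisting of the part in $x\le0$ of the front and back faces, the part in $x\ge 0$ of the top and bottom faces, and the square $W\cap\{x=0\}$. Paste them again as follows, where the permutation $\sigma$ means that sheet $i$ continues as sheet $\sigma(i)$: * across $D_1$ and $D_2$: the transposition $(2,3)$; * across the square, in the direction of increasing $x$: the cycle $\rho=(1,2,3)$; * leaving $W$ through the back face in $x\le0$: $\rho$; through the front face in $-sh\le x\le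 0$: $\rho$; through the front face in $x\le -sh$: $\rho^{-1}$; * leaving $W$ through the bottom face in $x\ge0$: $\rho^{-1}$; through the top face in $0\le x\le sh$: $\rho^{-1}$; through the top face in $x\ge sh$: $\rho$. Let $p:Y\to B$ be the resulting space with the quotient topology and its projection. More generally, for a homeomorphism $\Phi$ of $\mathbb R^3$, carry out the same construction with all curves and cut surfaces replaced by their images under $\Phi$; the resulting map is again called $p:Y\to B$. Let $a$ be the loop in $B$ that is the image under $\Phi$ of the circle of radius $\frac{R-1}2$ and centre $(-sh,-R,-\frac12)$ in the plane $z=-\frac12$, based at the image of $(-sh,-R-\frac{R-1}2,-\frac12)$. It circles once around the wire $C_1$, crosses $D_1$ once, and does not meet the rest of the cut surface. **Proposition.** For all such $h,s,R,\Phi$: 1. $p:Y\to B$ is a covering map all of whose fibres have exactly three points, and $Y$ is path connected. 2. The cover $p$ is not normal: it is not true that for all $y,\eta\in Y$ with $p(y)=p(\eta)$ there is a deck transformation $\psi$ (a homeomorphism $\psi:Y\to Y$ with $p\circ\psi=p$) with $\psi(y)=\eta$. 3. The identity is the only deck transformation of $p$. 4. For each $k\in\{1,2,3\}$ the loop $a$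 has exactly one lift to $Y$ that starts at the point on sheet $k$ over the base point; it ends at the point on sheet $\tau(k)$ over the base point, where $\tau=(2,3)$. This lift is closed if $k=1$ and not closed if $k=2,3$. -/

import Mathlib

open Set

noncomputable section

/-! ## Covers, deck transformations, normality -/

/-- A deck transformation of `p : Y → X`: a self-homeomorphism of `Y` over `X`. -/
def IsDeckTransformation {Y X : Type*} [TopologicalSpace Y] (p : Y → X) (ψ : Y ≃ₜ Y) : Prop :=
  ∀ y, p (ψ y) = p y

/-- `p : Y → X` is normal if the deck transformations act transitively on each fibre. -/
def IsNormalCover {Y X : Type*} [TopologicalSpace Y] (p : Y → X) : Prop :=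
  ∀ y η, p y = p η → ∃ ψ : Y ≃ₜ Y, IsDeckTransformation p ψ ∧ ψ y = η

/-! ## The system of curves -/

/-- Euclidean three-space. -/
abbrev E3 : Type := EuclideanSpace ℝ (Fin 3)

/-- A choice of the geometry: the parameters `h`, `s` of the wedge with straight edges and of the
invisible wires, the size `R` of the rectangles into which the wires are closed up outside of the
wedge, and an ambient homeomorphism `Φ` of three-space, by which the whole figure is deformed
(`Φ = id` is the polygonal figure itself). -/
structure WedgeGeometry where
  h : ℝ
  s : ℝ
  R : ℝ
  h_pos : 0 < h
  s_pos : 0 < s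
  s_lt_one : s < 1
  one_lt_R : 1 < R
  Φ : E3 ≃ₜ E3

namespace WedgeGeometry

variable (G : WedgeGeometry)

/-- Upper left vertex. -/
def vUL : E3 := !₂[-G.h, 0, 1]
/-- Lower left vertex. -/
def vLL : E3 := !₂[-G.h, 0, -1]
/-- Upper right vertex (seen by an observer in the direction `(0, -1, 1)`). -/
def vUR : E3 := !₂[G.h, 1, 0]
/-- Lower right vertex. -/
def vLR : E3 := !₂[G.h, -1, 0]

def shortEdge1 : Set E3 := segment ℝ G.vLL G.vUL
def shortEdge2 : Set E3 := segment ℝ G.vLR G.vUR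
def longEdge1 : Set E3 := segment ℝ G.vUR G.vUL
def longEdge2 : Set E3 := segment ℝ G.vLR G.vUL
def longEdge3 : Set E3 := segment ℝ G.vUR G.vLL
def longEdge4 : Set E3 := segment ℝ G.vLR G.vLL

/-- The one-skeleton of the wedge. -/
def edges : Set E3 :=
  (G.shortEdge1 ∪ G.shortEdge2) ∪ (G.longEdge1 ∪ G.longEdge2 ∪ G.longEdge3 ∪ G.longEdge4)

/-- The flat disk bounded by the first invisible wire; it is crossed by the long edges 2 and 4. -/
def disk1 : Set E3 :=
  {q | q 0 = -(G.s * G.h) ∧ -G.R ≤ q 1 ∧ q 1 ≤ 0 ∧ |q 2| ≤ G.R}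

/-- The flat disk bounded by the second invisible wire; it is crossed by the long edges 1 and 2. -/
def disk2 : Set E3 :=
  {q | q 0 = G.s * G.h ∧ |q 1| ≤ G.R ∧ 0 ≤ q 2 ∧ q 2 ≤ G.R}

/-- The first invisible wire: the perimeter of `disk1`. Inside the wedge it is the line through
`(-s h, 0, 0)` in the direction of the third axis. -/
def wire1 : Set E3 := {q | q ∈ G.disk1 ∧ (q 1 = -G.R ∨ q 1 = 0 ∨ |q 2| = G.R)}

/-- The second invisible wire: the perimeter of `disk2`. Inside the wedge it is the line through
`(s h, 0, 0)` in the direction of the second axis. -/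
def wire2 : Set E3 := {q | q ∈ G.disk2 ∧ (|q 1| = G.R ∨ q 2 = 0 ∨ q 2 = G.R)}

/-- The removed system of curves, before the deformation by `Φ`. -/
def curves : Set E3 := G.edges ∪ (G.wire1 ∪ G.wire2)

/-- The base space, i.e. the complement of the (deformed) system of curves. -/
abbrev Base : Type := {x : E3 // x ∉ G.Φ '' G.curves}

/-- The point of the undeformed figure that corresponds to a point of the base space. -/
def model (x : G.Base) : E3 := G.Φ.symm x.1

/-! ## Cutting -/

/-- The solid wedge (the convex hull of the four vertices). -/
def wedge : Set E3 := {q | 2 * G.h * |q 1| ≤ G.h + q 0 ∧ 2 * G.h * |q 2| ≤ G.h - q 0}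

/-- The closure of the complement of the solid wedge. -/
def outside : Set E3 := {q | G.h + q 0 ≤ 2 * G.h * |q 1| ∨ G.h - q 0 ≤ 2 * G.h * |q 2|}

def frontFace : Set E3 := {q | q ∈ G.wedge ∧ 2 * G.h * q 1 = -(G.h + q 0)}
def backFace : Set E3 := {q | q ∈ G.wedge ∧ 2 * G.h * q 1 = G.h + q 0}
def topFace : Set E3 := {q | q ∈ G.wedge ∧ 2 * G.h * q 2 = G.h - q 0}
def bottomFace : Set E3 := {q | q ∈ G.wedge ∧ 2 * G.h * q 2 = -(G.h - q 0)}

/-- The surface along which the sheets are cut: the two disks, and the large surface, which is made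
of the left halves of the front and back faces of the wedge, the right halves of its top and bottom
faces and the square in which the plane in the middle meets the wedge. -/
def cutSurface : Set E3 :=
  (G.disk1 ∪ G.disk2) ∪
  (((G.frontFace ∪ G.backFace) ∩ {q | q 0 ≤ 0}) ∪ ((G.topFace ∪ G.bottomFace) ∩ {q | 0 ≤ q 0}) ∪
    (G.wedge ∩ {q | q 0 = 0}))

/-- For the purpose of cutting, space is divided into eight closed cells, by the boundary of the
wedge (`true`: inside, `false`: outside) and by the three planes in which the first coordinate is
`-s h`, `0`, `s h` (slabs `0, 1, 2, 3` from left to right). The walls between the cells contain the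
whole cut surface; the parts of the walls that do not belong to it are pasted back by the identity.
-/
abbrev Cell : Type := Bool × Fin 4

/-- The part of space that is labelled by a cell. -/
def cellSet (c : Cell) : Set E3 :=
  (if c.1 = true then G.wedge else G.outside) ∩
  (match c.2 with
    | 0 => {q | q 0 ≤ -(G.s * G.h)}
    | 1 => {q | -(G.s * G.h) ≤ q 0 ∧ q 0 ≤ 0}
    | 2 => {q | 0 ≤ q 0 ∧ q 0 ≤ G.s * G.h}
    | 3 => {q | G.s * G.h ≤ q 0})

/-- Three copies (the sheets, numbered by `Fin 3`, so that `0, 1, 2` are the sheets 1, 2, 3) of the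
base space, cut into cells: the disjoint union of the cells of the three copies. -/
abbrev CutSheets : Type :=
  {u : Cell × G.Base × Fin 3 // G.model u.2.1 ∈ G.cellSet u.1}

/-! ## Pasting -/

/-- The cyclic permutation (1,2,3) of the sheets. -/
abbrev cyc : Equiv.Perm (Fin 3) := finRotate 3

/-- The transposition (2,3) of the sheets. -/
abbrev tr : Equiv.Perm (Fin 3) := Equiv.swap 1 2

/-- `G.Crossing c d q σ`: when the wall between the adjacent cells `c` and `d` is crossed at `q` in
the direction from `c` to `d`, sheet `i` continues as sheet `σ i`. -/
inductive Crossing : Cell → Cell → E3 → Equiv.Perm (Fin 3) → Prop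
  -- the plane of the first disk: sheets 2 and 3 are exchanged across the disk
  | disk1 (b : Bool) (q : E3) (hq : q ∈ G.disk1) : Crossing (b, 0) (b, 1) q tr
  | uncut1 (b : Bool) (q : E3) (hq : q ∉ G.disk1) : Crossing (b, 0) (b, 1) q 1
  -- the plane of the second disk: sheets 2 and 3 are exchanged across the disk
  | disk2 (b : Bool) (q : E3) (hq : q ∈ G.disk2) : Crossing (b, 2) (b, 3) q tr
  | uncut2 (b : Bool) (q : E3) (hq : q ∉ G.disk2) : Crossing (b, 2) (b, 3) q 1
  -- the plane in the middle: it is cut along the central square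
  | square (q : E3) : Crossing (true, 1) (true, 2) q cyc
  | uncutMid (q : E3) : Crossing (false, 1) (false, 2) q 1
  -- the left half of the boundary of the wedge: the front and back faces are cut; the permutation
  -- on the front face changes, by conjugation, where this face goes through the first disk
  | frontLeft (q : E3) (hq : q ∈ G.frontFace) : Crossing (true, 0) (false, 0) q cyc⁻¹
  | frontMid (q : E3) (hq : q ∈ G.frontFace) : Crossing (true, 1) (false, 1) q cyc
  | back (i : Fin 4) (hi : i = 0 ∨ i = 1) (q : E3) (hq : q ∈ G.backFace) :
      Crossing (true, i) (false, i) q cyc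
  | uncutLeft (i : Fin 4) (hi : i = 0 ∨ i = 1) (q : E3) (hq : q ∉ G.frontFace ∪ G.backFace) :
      Crossing (true, i) (false, i) q 1
  -- the right half of the boundary of the wedge: the top and bottom faces are cut; the permutation
  -- on the top face changes, by conjugation, where this face goes through the second disk
  | topMid (q : E3) (hq : q ∈ G.topFace) : Crossing (true, 2) (false, 2) q cyc⁻¹
  | topRight (q : E3) (hq : q ∈ G.topFace) : Crossing (true, 3) (false, 3) q cyc
  | bottom (i : Fin 4) (hi : i = 2 ∨ i = 3) (q : E3) (hq : q ∈ G.bottomFace) :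
      Crossing (true, i) (false, i) q cyc⁻¹
  | uncutRight (i : Fin 4) (hi : i = 2 ∨ i = 3) (q : E3) (hq : q ∉ G.topFace ∪ G.bottomFace) :
      Crossing (true, i) (false, i) q 1

/-- The gluing is the identity off the cut surface. -/
theorem Crossing.mem_cutSurface {c d : Cell} {q : E3} {σ : Equiv.Perm (Fin 3)}
    (hσ : G.Crossing c d q σ) (hc : q ∈ G.cellSet c) (hd : q ∈ G.cellSet d) (h1 : σ ≠ 1) :
    q ∈ G.cutSurface := by
  have hpos := mul_pos G.s_pos G.h_pos
  cases hσ with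
  | disk1 b _ hq => exact Or.inl (Or.inl hq)
  | disk2 b _ hq => exact Or.inl (Or.inr hq)
  | square => exact Or.inr (Or.inr ⟨hc.1, le_antisymm hc.2.2 hd.2.1⟩)
  | frontLeft _ hq =>
    exact Or.inr (Or.inl (Or.inl ⟨Or.inl hq, le_trans (show q 0 ≤ -(G.s * G.h) from hc.2) (by linarith)⟩))
  | frontMid _ hq => exact Or.inr (Or.inl (Or.inl ⟨Or.inl hq, hc.2.2⟩))
  | back i hi _ hq =>
    rcases hi with rfl | rfl
    · exact Or.inr (Or.inl (Or.inl ⟨Or.inr hq, le_trans (show q 0 ≤ -(G.s * G.h) from hc.2) (by linarith)⟩))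
    · exact Or.inr (Or.inl (Or.inl ⟨Or.inr hq, hc.2.2⟩))
  | topMid _ hq => exact Or.inr (Or.inl (Or.inr ⟨Or.inl hq, hc.2.1⟩))
  | topRight _ hq =>
    exact Or.inr (Or.inl (Or.inr ⟨Or.inl hq, le_trans hpos.le hc.2⟩))
  | bottom i hi _ hq =>
    rcases hi with rfl | rfl
    · exact Or.inr (Or.inl (Or.inr ⟨Or.inr hq, hc.2.1⟩))
    · exact Or.inr (Or.inl (Or.inr ⟨Or.inr hq, le_trans hpos.le hc.2⟩))
  | _ => exact absurd rfl h1

/-- Two points of the cut sheets are pasted if they lie over the same point of the base space, on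
the two sides of a wall, and their sheets correspond under the permutation of this wall. -/
def Paste (u v : G.CutSheets) : Prop :=
  u.1.2.1 = v.1.2.1 ∧
    ∃ σ, G.Crossing u.1.1 v.1.1 (G.model u.1.2.1) σ ∧ v.1.2.2 = σ u.1.2.2

/-- The covering space, with the quotient topology. -/
abbrev Cover : Type := Quot G.Paste

/-- The projection of the cover. -/
def proj : G.Cover → G.Base := Quot.lift (fun u => u.1.2.1) (fun _ _ huv => huv.1)

/-! ## The loop `a` -/

/-- A circle, in the plane of height `-1/2`, around the side of the first invisible wire that is
in front of the wedge. It stays away from the wedge and from the second disk, and goes through the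
first disk exactly once, at time `1/2`. -/
def circleA (t : ℝ) : E3 :=
  !₂[-(G.s * G.h) + (G.R - 1) / 2 * Real.sin (2 * Real.pi * t),
    -G.R - (G.R - 1) / 2 * Real.cos (2 * Real.pi * t), -(1 / 2)]

theorem edges_bound {q : E3} (hq : q ∈ G.edges) : -1 ≤ q 1 := by
  simp only [edges, shortEdge1, shortEdge2, longEdge1, longEdge2, longEdge3, longEdge4, mem_union,
    segment, mem_ofPred_eq] at hq
  rcases hq with (⟨a, b, ha, hb, hab, rfl⟩ | ⟨a, b, ha, hb, hab, rfl⟩) |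
      (((⟨a, b, ha, hb, hab, rfl⟩ | ⟨a, b, ha, hb, hab, rfl⟩) |
        ⟨a, b, ha, hb, hab, rfl⟩) | ⟨a, b, ha, hb, hab, rfl⟩) <;>
    simp [vUL, vLL, vUR, vLR] <;> linarith

theorem circleA_notMem (t : ℝ) : G.circleA t ∉ G.curves := by
  have hR := G.one_lt_R
  have h1 : Real.cos (2 * Real.pi * t) ≤ 1 := Real.cos_le_one _
  have h2 : -1 ≤ Real.cos (2 * Real.pi * t) := Real.neg_one_le_cos _
  rintro (hq | ⟨hd, hq⟩ | ⟨hd, -⟩)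
  · have := G.edges_bound hq
    simp only [circleA, PiLp.toLp_apply, Matrix.cons_val_one, Matrix.cons_val_zero] at this
    nlinarith
  · obtain ⟨h0, -⟩ := hd
    simp [circleA] at h0 hq
    have hsin : Real.sin (2 * Real.pi * t) = 0 := by
      rcases h0 with h0 | h0
      · linarith
      · exact h0
    rcases hq with hq | hq | hq
    · have hcos : Real.cos (2 * Real.pi * t) = 0 := by
        rcases hq with hq | hq
        · linarith
        · exact hq
      have := Real.sin_sq_add_cos_sq (2 * Real.pi * t)
      rw [hsin, hcos] at this
      norm_num at this
    · nlinarith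
    · norm_num at hq
      linarith
  · obtain ⟨-, -, h3, -⟩ := hd
    simp [circleA] at h3
    norm_num at h3

/-- The points of the loop `a` in the base space. -/
def pointA (t : ℝ) : G.Base :=
  ⟨G.Φ (G.circleA t), fun ⟨_, hq, he⟩ => G.circleA_notMem t (G.Φ.injective he ▸ hq)⟩

theorem continuous_pointA : Continuous G.pointA := by
  refine Continuous.subtype_mk (G.Φ.continuous.comp ?_) _
  refine (PiLp.continuous_toLp 2 _).comp (continuous_pi fun i => ?_)
  fin_cases i <;> simp <;> fun_prop

/-- The base point. -/
def basePoint : G.Base := G.pointA 0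

/-- The loop `a`. -/
def loopA : Path G.basePoint G.basePoint where
  toFun t := G.pointA t
  continuous_toFun := G.continuous_pointA.comp continuous_subtype_val
  source' := rfl
  target' := by
    apply Subtype.ext
    simp [pointA, basePoint, circleA]

theorem model_basePoint_mem : G.model G.basePoint ∈ G.cellSet (false, 0) := by
  have hR := G.one_lt_R
  have hh := G.h_pos
  have hs := G.s_pos
  have hm : G.model G.basePoint = G.circleA 0 := by simp [model, basePoint, pointA]
  rw [hm]
  simp only [cellSet, outside, circleA]
  refine ⟨Or.inl ?_, ?_⟩
  · simp only [Matrix.cons_val_one, Matrix.cons_val_zero, mul_zero, Real.sin_zero, Real.cos_zero]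
    rw [abs_of_neg (by linarith)]
    nlinarith [mul_pos hs hh]
  · simp

/-- The point over the base point on a given sheet. -/
def sheetPoint (k : Fin 3) : G.Cover :=
  Quot.mk _ ⟨((false, 0), G.basePoint, k), G.model_basePoint_mem⟩

end WedgeGeometry

end

/-!
Everything is controlled by the pattern of cells and walls at the points of the undeformed figure.
Call a renumbering `μ` of the sheets, one permutation for each cell, a potential at `q` if every wall
through `q`, crossed from `c` to `d` by `σ`, satisfies `μ d = σ * μ c`.

*Covering.* Off the removed curves a potential exists (`exists_potential`). The only condition arises
where the boundary of the wedge meets one of the three planes: there the permutations around the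
common line of four cells must have trivial product, and they do because conjugation by the
transposition inverts the 3-cycle. As cells and faces are closed, and disks and faces are relatively
open once their boundary curves are removed, the pattern at nearby points is a part of the pattern at
`q` (`eventually_crossing`), so that one potential serves a whole neighbourhood `U`. It trivializes
the cover over `U`: the sheet number relative to `μ` descends to the quotient, and the inverse map
`U × Fin 3 → Cover` is defined cell by cell and glued along a finite closed cover
(`exists_lift_of_closed_cover`). Its pieces agree because any two cells at a point are connected by
walls through that point (`pt_eq_pt`).

*Connectedness.* The inner cells are convex, and each outer cell is a union of four convex pieces,
neighbouring ones having interior points in common. The removed curves meet only the boundaries of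
these pieces, which are therefore connected by segments even after the removal (`IsCore`). Far away
the outer cells of one sheet are joined to each other, each inner cell is joined to the outer one
through an uncut face, and the back face joins sheet `i` to sheet `cyc i`; the 3-cycle is transitive.

*The loop and deck transformations.* The lift of the loop `a` on sheet `k` is written down explicitly
(`exists_lift_loopA`): it changes to sheet `tr k` when it goes through the first disk, and it is
unique by the general theory of covers. A deck transformation maps closed lifts of `a` to closed
lifts. As `tr` fixes one sheet only, it fixes the point on this sheet over the base point, and so it
is the identity, the cover being connected. Since the fibres have three points, the cover is not
normal.
-/

noncomputable section

open Topology

namespace WedgeGeometry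

variable (G : WedgeGeometry)

/-! ### Points of the cover -/

/-- The point of the cover over `x` that lies on sheet `i` of the cell `c`. -/
def pt (c : Cell) (x : G.Base) (i : Fin 3) (hx : G.model x ∈ G.cellSet c) : G.Cover :=
  Quot.mk _ ⟨(c, x, i), hx⟩

/-- The point of the base space that corresponds to a point of the undeformed figure. -/
def ofModel (q : E3) (hq : q ∉ G.curves) : G.Base :=
  ⟨G.Φ q, fun ⟨_, hq', he⟩ => hq (G.Φ.injective he ▸ hq')⟩

@[simp] theorem model_ofModel (q : E3) (hq : q ∉ G.curves) : G.model (G.ofModel q hq) = q := by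
  simp [model, ofModel]

theorem model_notMem (x : G.Base) : G.model x ∉ G.curves := fun h =>
  x.2 ⟨_, h, by simp [model]⟩

@[simp] theorem ofModel_model (x : G.Base) : G.ofModel (G.model x) (G.model_notMem x) = x := by
  apply Subtype.ext; simp [model, ofModel]

theorem continuous_model : Continuous G.model :=
  G.Φ.symm.continuous.comp continuous_subtype_val

theorem continuous_proj : Continuous G.proj :=
  continuous_quot_lift _ (continuous_subtype_val.snd.fst)

@[simp] theorem proj_pt (c : Cell) (x : G.Base) (i : Fin 3) (hx : G.model x ∈ G.cellSet c) :
    G.proj (G.pt c x i hx) = x := rfl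

theorem exists_eq_pt (y : G.Cover) : ∃ c x i hx, y = G.pt c x i hx := by
  induction y using Quot.ind with
  | mk u => exact ⟨u.1.1, u.1.2.1, u.1.2.2, u.2, rfl⟩

theorem pt_eq_of_crossing {c d : Cell} {x : G.Base} {i j : Fin 3} {σ : Equiv.Perm (Fin 3)}
    (hc : G.model x ∈ G.cellSet c) (hd : G.model x ∈ G.cellSet d)
    (h : G.Crossing c d (G.model x) σ) (hij : j = σ i) : G.pt c x i hc = G.pt d x j hd :=
  Quot.sound ⟨rfl, σ, h, hij⟩

/-! ### The closed cells -/

/-- The four closed slabs that form the second component of a cell. -/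
def slab (i : Fin 4) : Set E3 :=
  match i with
    | 0 => {q | q 0 ≤ -(G.s * G.h)}
    | 1 => {q | -(G.s * G.h) ≤ q 0 ∧ q 0 ≤ 0}
    | 2 => {q | 0 ≤ q 0 ∧ q 0 ≤ G.s * G.h}
    | 3 => {q | G.s * G.h ≤ q 0}

theorem isClosed_wedge : IsClosed G.wedge := by
  change IsClosed ({q : E3 | 2 * G.h * |q 1| ≤ G.h + q 0} ∩ {q : E3 | 2 * G.h * |q 2| ≤ G.h - q 0})
  exact (isClosed_le (by fun_prop) (by fun_prop)).inter (isClosed_le (by fun_prop) (by fun_prop))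

theorem isClosed_outside : IsClosed G.outside := by
  change IsClosed ({q : E3 | G.h + q 0 ≤ 2 * G.h * |q 1|} ∪ {q : E3 | G.h - q 0 ≤ 2 * G.h * |q 2|})
  exact (isClosed_le (by fun_prop) (by fun_prop)).union (isClosed_le (by fun_prop) (by fun_prop))

theorem isClosed_slab (i : Fin 4) : IsClosed (G.slab i) := by
  fin_cases i
  · exact isClosed_le (by fun_prop) (by fun_prop)
  · exact isClosed_Icc.preimage (f := fun q : E3 => q 0) (by fun_prop)
  · exact isClosed_Icc.preimage (f := fun q : E3 => q 0) (by fun_prop)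
  · exact isClosed_le (by fun_prop) (by fun_prop)

theorem isClosed_cellSet (c : Cell) : IsClosed (G.cellSet c) := by
  obtain ⟨b, i⟩ := c
  refine IsClosed.inter ?_ (G.isClosed_slab i)
  cases b
  · exact G.isClosed_outside
  · exact G.isClosed_wedge

theorem mem_wedge_or_outside (q : E3) : q ∈ G.wedge ∨ q ∈ G.outside := by
  by_cases h1 : 2 * G.h * |q 1| ≤ G.h + q 0
  · by_cases h2 : 2 * G.h * |q 2| ≤ G.h - q 0
    · exact Or.inl ⟨h1, h2⟩
    · exact Or.inr (Or.inr (not_le.1 h2).le)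
  · exact Or.inr (Or.inl (not_le.1 h1).le)

theorem exists_mem_slab (q : E3) : ∃ i, q ∈ G.slab i := by
  by_cases h0 : q 0 ≤ -(G.s * G.h)
  · exact ⟨0, h0⟩
  by_cases h1 : q 0 ≤ 0
  · exact ⟨1, (not_le.1 h0).le, h1⟩
  by_cases h2 : q 0 ≤ G.s * G.h
  · exact ⟨2, (not_le.1 h1).le, h2⟩
  · exact ⟨3, (not_le.1 h2).le⟩

theorem exists_mem_cellSet (q : E3) : ∃ c, q ∈ G.cellSet c := by
  obtain ⟨i, hi⟩ := G.exists_mem_slab q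
  rcases G.mem_wedge_or_outside q with h | h
  · exact ⟨(true, i), h, hi⟩
  · exact ⟨(false, i), h, hi⟩

/-! ### Piecewise definition of maps into the cover -/

/-- Maps into the cover can be defined piecewise: a continuous map to the base lifts if its domain is
covered by finitely many closed sets, each of which is mapped to a cell and equipped with a locally
constant choice of a sheet, such that these choices are compatible on the overlaps. -/
theorem exists_lift_of_closed_cover {T ι : Type*} [TopologicalSpace T] [Finite ι]
    (f : T → G.Base) (hf : Continuous f) (A : ι → Set T) (hA : ∀ n, IsClosed (A n))
    (hcov : ∀ t, ∃ n, t ∈ A n) (c : ι → Cell) (σ : ι → T → Fin 3) (hσ : ∀ n, Continuous (σ n))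
    (hmem : ∀ n, ∀ t ∈ A n, G.model (f t) ∈ G.cellSet (c n))
    (hag : ∀ m n t (hm : t ∈ A m) (hn : t ∈ A n),
      G.pt (c m) (f t) (σ m t) (hmem m t hm) = G.pt (c n) (f t) (σ n t) (hmem n t hn)) :
    ∃ F : C(T, G.Cover), ∀ n t (h : t ∈ A n), F t = G.pt (c n) (f t) (σ n t) (hmem n t h) := by
  choose N hN using hcov
  let F : T → G.Cover := fun t => G.pt (c (N t)) (f t) (σ (N t) t) (hmem _ t (hN t))
  have hF : ∀ n t (h : t ∈ A n), F t = G.pt (c n) (f t) (σ n t) (hmem n t h) :=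
    fun n t h => hag _ _ t (hN t) h
  refine ⟨⟨F, ?_⟩, hF⟩
  refine (locallyFinite_of_finite A).continuous (iUnion_eq_univ_iff.2 fun t => ⟨_, hN t⟩) hA ?_
  intro n
  rw [continuousOn_iff_continuous_domRestrict]
  have : (A n).domRestrict F = fun t : A n => Quot.mk _
      (⟨(c n, f t.1, σ n t.1), hmem n t.1 t.2⟩ : G.CutSheets) := by
    funext t
    exact hF n t.1 t.2
  rw [this]
  refine continuous_quot_mk.comp (Continuous.subtype_mk ?_ _)
  exact continuous_const.prodMk ((hf.comp continuous_subtype_val).prodMk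
    ((hσ n).comp continuous_subtype_val))

/-- Sheets that are compatible with all walls at `x` define one point of the cover over `x`,
because any two of the cells that meet at `x` are connected by walls through `x`. -/
theorem pt_eq_pt {x : G.Base} {i : Cell → Fin 3}
    (hi : ∀ c d σ, G.model x ∈ G.cellSet c → G.model x ∈ G.cellSet d →
      G.Crossing c d (G.model x) σ → i d = σ (i c))
    (c d : Cell) (hc : G.model x ∈ G.cellSet c) (hd : G.model x ∈ G.cellSet d) :
    G.pt c x (i c) hc = G.pt d x (i d) hd := by
  have step : ∀ c d σ (hc : G.model x ∈ G.cellSet c) (hd : G.model x ∈ G.cellSet d),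
      G.Crossing c d (G.model x) σ → G.pt c x (i c) hc = G.pt d x (i d) hd :=
    fun c d σ hc hd h => G.pt_eq_of_crossing hc hd h (hi c d σ hc hd h)
  have hpos := mul_pos G.s_pos G.h_pos
  have vert : ∀ j (h1 : G.model x ∈ G.cellSet (true, j)) (h2 : G.model x ∈ G.cellSet (false, j)),
      G.pt _ x (i (true, j)) h1 = G.pt _ x (i (false, j)) h2 := by
    intro j h1 h2
    have hj : (j = 0 ∨ j = 1) ∨ (j = 2 ∨ j = 3) := by omega
    rcases hj with hj | hj
    · by_cases hb : G.model x ∈ G.backFace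
      · exact step _ _ _ h1 h2 (.back j hj _ hb)
      by_cases hf : G.model x ∈ G.frontFace
      · rcases hj with rfl | rfl
        · exact step _ _ _ h1 h2 (.frontLeft _ hf)
        · exact step _ _ _ h1 h2 (.frontMid _ hf)
      · exact step _ _ _ h1 h2 (.uncutLeft j hj _ (by simp [hb, hf]))
    · by_cases hb : G.model x ∈ G.bottomFace
      · exact step _ _ _ h1 h2 (.bottom j hj _ hb)
      by_cases hf : G.model x ∈ G.topFace
      · rcases hj with rfl | rfl
        · exact step _ _ _ h1 h2 (.topMid _ hf)
        · exact step _ _ _ h1 h2 (.topRight _ hf)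
      · exact step _ _ _ h1 h2 (.uncutRight j hj _ (by simp [hb, hf]))
  have hor01 : ∀ b (h1 : G.model x ∈ G.cellSet (b, 0)) (h2 : G.model x ∈ G.cellSet (b, 1)),
      G.pt _ x (i (b, 0)) h1 = G.pt _ x (i (b, 1)) h2 := by
    intro b h1 h2
    by_cases hd : G.model x ∈ G.disk1
    · exact step _ _ _ h1 h2 (.disk1 b _ hd)
    · exact step _ _ _ h1 h2 (.uncut1 b _ hd)
  have hor12 : ∀ b (h1 : G.model x ∈ G.cellSet (b, 1)) (h2 : G.model x ∈ G.cellSet (b, 2)),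
      G.pt _ x (i (b, 1)) h1 = G.pt _ x (i (b, 2)) h2 := by
    intro b h1 h2
    cases b
    · exact step _ _ _ h1 h2 (.uncutMid _)
    · exact step _ _ _ h1 h2 (.square _)
  have hor23 : ∀ b (h1 : G.model x ∈ G.cellSet (b, 2)) (h2 : G.model x ∈ G.cellSet (b, 3)),
      G.pt _ x (i (b, 2)) h1 = G.pt _ x (i (b, 3)) h2 := by
    intro b h1 h2
    by_cases hd : G.model x ∈ G.disk2
    · exact step _ _ _ h1 h2 (.disk2 b _ hd)
    · exact step _ _ _ h1 h2 (.uncut2 b _ hd)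
  have hor : ∀ b j k (h1 : G.model x ∈ G.cellSet (b, j)) (h2 : G.model x ∈ G.cellSet (b, k)),
      G.pt _ x (i (b, j)) h1 = G.pt _ x (i (b, k)) h2 := by
    intro b j k h1 h2
    have h1' := h1.2
    have h2' := h2.2
    fin_cases j <;> fin_cases k <;> first
      | rfl
      | exact hor01 b h1 h2
      | exact hor12 b h1 h2
      | exact hor23 b h1 h2
      | exact (hor01 b h2 h1).symm
      | exact (hor12 b h2 h1).symm
      | exact (hor23 b h2 h1).symm
      | (exfalso; simp at h1' h2'; linarith)
  obtain ⟨b, j⟩ := c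
  obtain ⟨b', k⟩ := d
  have hm : G.model x ∈ G.cellSet (b, k) := ⟨hc.1, hd.2⟩
  refine (hor b j k hc hm).trans ?_
  cases b <;> cases b'
  · rfl
  · exact (vert k hd hm).symm
  · exact vert k hm hd
  · rfl

/-! ### Edges and faces of the wedge -/

/-- The long edges are where both inequalities that define the wedge are equalities. -/
theorem longEdge_mem {q : E3} (h1 : 2 * G.h * |q 1| = G.h + q 0)
    (h2 : 2 * G.h * |q 2| = G.h - q 0) : q ∈ G.edges := by
  have hh := G.h_pos
  have e1 : (G.h - q 0) / (2 * G.h) = |q 2| := by rw [← h2]; field_simp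
  have e2 : (G.h + q 0) / (2 * G.h) = |q 1| := by rw [← h1]; field_simp
  have hsum : |q 1| + |q 2| = 1 := by rw [← e1, ← e2]; field_simp; ring
  have h0 : q 0 = G.h * |q 1| - G.h * |q 2| := by linarith
  have a1 := abs_nonneg (q 1)
  have a2 := abs_nonneg (q 2)
  -- The barycentric coordinates of `q` on its edge are `|q 1|` and `|q 2|`.
  have key : ∀ ε δ : ℝ, |q 1| * ε = q 1 → |q 2| * δ = q 2 →
      q ∈ segment ℝ (!₂[G.h, ε, 0] : E3) !₂[-G.h, 0, δ] := by
    intro ε δ hε hδ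
    refine ⟨|q 1|, |q 2|, a1, a2, hsum, ?_⟩
    ext i
    fin_cases i
    · simp; linarith
    · simpa using hε
    · simpa using hδ
  right
  rcases le_total 0 (q 1) with k1 | k1 <;> rcases le_total 0 (q 2) with k2 | k2
  · exact Or.inl (Or.inl (Or.inl (key 1 1 (by simp [abs_of_nonneg k1]) (by simp [abs_of_nonneg k2]))))
  · exact Or.inl (Or.inr (key 1 (-1) (by simp [abs_of_nonneg k1]) (by simp [abs_of_nonpos k2])))
  · exact Or.inl (Or.inl (Or.inr (key (-1) 1 (by simp [abs_of_nonpos k1]) (by simp [abs_of_nonneg k2]))))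
  · exact Or.inr (key (-1) (-1) (by simp [abs_of_nonpos k1]) (by simp [abs_of_nonpos k2]))

theorem shortEdge1_mem {q : E3} (hq : q ∈ G.wedge) (h0 : G.h + q 0 = 0) : q ∈ G.edges := by
  have hh := G.h_pos
  obtain ⟨h1, h2⟩ := hq
  have b1 : q 1 = 0 := by
    rw [h0] at h1
    have : |q 1| ≤ 0 := by
      by_contra hc
      nlinarith [mul_pos hh (not_le.1 hc)]
    exact abs_nonpos_iff.1 this
  have b2 : |q 2| ≤ 1 := by
    by_contra hc
    nlinarith [mul_lt_mul_of_pos_left (not_le.1 hc) hh]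
  obtain ⟨b3, b4⟩ := abs_le.1 b2
  refine Or.inl (Or.inl ⟨(1 - q 2) / 2, (1 + q 2) / 2, by linarith, by linarith, by ring, ?_⟩)
  ext i
  fin_cases i
  · simp [vLL, vUL]; linarith
  · simp [vLL, vUL, b1]
  · simp [vLL, vUL]; ring

theorem shortEdge2_mem {q : E3} (hq : q ∈ G.wedge) (h0 : G.h - q 0 = 0) : q ∈ G.edges := by
  have hh := G.h_pos
  obtain ⟨h1, h2⟩ := hq
  have b1 : q 2 = 0 := by
    rw [h0] at h2
    have : |q 2| ≤ 0 := by
      by_contra hc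
      nlinarith [mul_pos hh (not_le.1 hc)]
    exact abs_nonpos_iff.1 this
  have b2 : |q 1| ≤ 1 := by
    by_contra hc
    nlinarith [mul_lt_mul_of_pos_left (not_le.1 hc) hh]
  obtain ⟨b3, b4⟩ := abs_le.1 b2
  refine Or.inl (Or.inr ⟨(1 - q 1) / 2, (1 + q 1) / 2, by linarith, by linarith, by ring, ?_⟩)
  ext i
  fin_cases i
  · simp [vLR, vUR]; linarith
  · simp [vLR, vUR]; ring
  · simp [vLR, vUR, b1]

/-- Besides lying in the wedge, a point of an edge satisfies one of three equations, according to
whether the edge is long, or short on the left, or short on the right. -/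
theorem edges_sub {q : E3} (hq : q ∈ G.edges) :
    q ∈ G.wedge ∧ ((2 * G.h * |q 1| = G.h + q 0 ∧ 2 * G.h * |q 2| = G.h - q 0) ∨
      G.h + q 0 = 0 ∨ G.h - q 0 = 0) := by
  have hh := G.h_pos
  have long : ∀ ε δ : ℝ, |ε| = 1 → |δ| = 1 → q ∈ segment ℝ (!₂[G.h, ε, 0] : E3) !₂[-G.h, 0, δ] →
      2 * G.h * |q 1| = G.h + q 0 ∧ 2 * G.h * |q 2| = G.h - q 0 := by
    rintro ε δ hε hδ ⟨a, b, ha, hb, hab, rfl⟩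
    have hb' : b = 1 - a := by linarith
    subst hb'
    constructor
    · simp [abs_mul, hε, abs_of_nonneg ha]; ring
    · simp [abs_mul, hδ, abs_of_nonneg hb]; ring
  have long' : ∀ ε δ : ℝ, |ε| = 1 → |δ| = 1 →
      q ∈ segment ℝ (!₂[G.h, ε, 0] : E3) !₂[-G.h, 0, δ] →
      q ∈ G.wedge ∧ ((2 * G.h * |q 1| = G.h + q 0 ∧ 2 * G.h * |q 2| = G.h - q 0) ∨
      G.h + q 0 = 0 ∨ G.h - q 0 = 0) := fun ε δ hε hδ h =>
    ⟨⟨(long ε δ hε hδ h).1.le, (long ε δ hε hδ h).2.le⟩, Or.inl (long ε δ hε hδ h)⟩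
  rcases hq with (⟨a, b, ha, hb, hab, rfl⟩ | ⟨a, b, ha, hb, hab, rfl⟩) | (((h | h) | h) | h)
  · refine ⟨⟨?_, ?_⟩, Or.inr (Or.inl ?_)⟩
    · simp [vLL, vUL]; nlinarith
    · have : |(a • G.vLL + b • G.vUL) 2| ≤ 1 := by
        simp [vLL, vUL, abs_le]; constructor <;> linarith
      have h2 := mul_le_mul_of_nonneg_left this hh.le
      have e : (a • G.vLL + b • G.vUL) 0 = -G.h := by
        simp [vLL, vUL]; rw [← neg_add, ← add_mul, hab, one_mul]
      rw [e]; linarith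
    · simp [vLL, vUL]; rw [← neg_add, ← add_mul, hab, one_mul]; ring
  · refine ⟨⟨?_, ?_⟩, Or.inr (Or.inr ?_)⟩
    · have : |(a • G.vLR + b • G.vUR) 1| ≤ 1 := by
        simp [vLR, vUR, abs_le]; constructor <;> linarith
      have h2 := mul_le_mul_of_nonneg_left this hh.le
      have e : (a • G.vLR + b • G.vUR) 0 = G.h := by
        simp [vLR, vUR]; rw [← add_mul, hab, one_mul]
      rw [e]; linarith
    · simp [vLR, vUR]; nlinarith
    · simp [vLR, vUR]; rw [← add_mul, hab, one_mul]; ring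
  · exact long' 1 1 (by simp) (by simp) h
  · exact long' (-1) 1 (by simp) (by simp) h
  · exact long' 1 (-1) (by simp) (by simp) h
  · exact long' (-1) (-1) (by simp) (by simp) h

/-- Away from the edges, at most one of the two inequalities that define the wedge is an
equality. -/
theorem wedge_cases {q : E3} (hq : q ∉ G.curves) (hw : q ∈ G.wedge) :
    2 * G.h * |q 1| < G.h + q 0 ∨ 2 * G.h * |q 2| < G.h - q 0 := by
  by_contra hc
  push Not at hc
  exact hq (Or.inl (G.longEdge_mem (le_antisymm hw.1 hc.1) (le_antisymm hw.2 hc.2)))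

theorem left_pos {q : E3} (hq : q ∉ G.curves) (hw : q ∈ G.wedge) : 0 < G.h + q 0 :=
  lt_of_le_of_ne ((by have := G.h_pos; positivity : (0 : ℝ) ≤ 2 * G.h * |q 1|).trans hw.1)
    fun h => hq (Or.inl (G.shortEdge1_mem hw h.symm))

theorem right_pos {q : E3} (hq : q ∉ G.curves) (hw : q ∈ G.wedge) : 0 < G.h - q 0 :=
  lt_of_le_of_ne ((by have := G.h_pos; positivity : (0 : ℝ) ≤ 2 * G.h * |q 2|).trans hw.2)
    fun h => hq (Or.inl (G.shortEdge2_mem hw h.symm))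

theorem mem_front_or_back {q : E3} :
    q ∈ G.frontFace ∪ G.backFace ↔ q ∈ G.wedge ∧ 2 * G.h * |q 1| = G.h + q 0 := by
  have hh := G.h_pos
  constructor
  · rintro (⟨hw, h⟩ | ⟨hw, h⟩)
    · refine ⟨hw, ?_⟩
      have h1 : 0 ≤ 2 * G.h * |q 1| := by positivity
      have : q 1 ≤ 0 := by
        by_contra hc
        nlinarith [hw.1, mul_pos hh (not_le.1 hc)]
      rw [abs_of_nonpos this]; linarith
    · refine ⟨hw, ?_⟩
      have h1 : 0 ≤ 2 * G.h * |q 1| := by positivity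
      have : 0 ≤ q 1 := by
        by_contra hc
        nlinarith [hw.1, mul_pos hh (neg_pos.2 (not_le.1 hc))]
      rw [abs_of_nonneg this]; linarith
  · rintro ⟨hw, h⟩
    rcases le_total 0 (q 1) with k | k
    · rw [abs_of_nonneg k] at h; exact Or.inr ⟨hw, h⟩
    · rw [abs_of_nonpos k] at h; exact Or.inl ⟨hw, by linarith⟩

theorem mem_top_or_bottom {q : E3} :
    q ∈ G.topFace ∪ G.bottomFace ↔ q ∈ G.wedge ∧ 2 * G.h * |q 2| = G.h - q 0 := by
  have hh := G.h_pos
  constructor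
  · rintro (⟨hw, h⟩ | ⟨hw, h⟩)
    · refine ⟨hw, ?_⟩
      have h1 : 0 ≤ 2 * G.h * |q 2| := by positivity
      have : 0 ≤ q 2 := by
        by_contra hc
        nlinarith [hw.2, mul_pos hh (neg_pos.2 (not_le.1 hc))]
      rw [abs_of_nonneg this]; linarith
    · refine ⟨hw, ?_⟩
      have h1 : 0 ≤ 2 * G.h * |q 2| := by positivity
      have : q 2 ≤ 0 := by
        by_contra hc
        nlinarith [hw.2, mul_pos hh (not_le.1 hc)]
      rw [abs_of_nonpos this]; linarith
  · rintro ⟨hw, h⟩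
    rcases le_total 0 (q 2) with k | k
    · rw [abs_of_nonneg k] at h; exact Or.inl ⟨hw, h⟩
    · rw [abs_of_nonpos k] at h; exact Or.inr ⟨hw, by linarith⟩

theorem notMem_back_of_mem_front {q : E3} (hq : q ∉ G.curves) (hf : q ∈ G.frontFace) :
    q ∉ G.backFace := fun hb => by
  have := G.left_pos hq hf.1
  have h1 := hf.2
  have h2 := hb.2
  linarith

theorem notMem_bottom_of_mem_top {q : E3} (hq : q ∉ G.curves) (hf : q ∈ G.topFace) :
    q ∉ G.bottomFace := fun hb => by
  have := G.right_pos hq hf.1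
  have h1 := hf.2
  have h2 := hb.2
  linarith

/-- Off the removed curves, a boundary point of the wedge lies either on the front or back face or
on the top or bottom face. -/
theorem boundary_cases {q : E3} (hq : q ∉ G.curves) (hw : q ∈ G.wedge) (ho : q ∈ G.outside) :
    (q ∈ G.frontFace ∪ G.backFace ∧ q ∉ G.topFace ∪ G.bottomFace) ∨
    (q ∉ G.frontFace ∪ G.backFace ∧ q ∈ G.topFace ∪ G.bottomFace) := by
  rw [mem_front_or_back, mem_top_or_bottom]
  rcases G.wedge_cases hq hw with h | h
  · refine Or.inr ⟨fun h' => h.ne h'.2, hw, ?_⟩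
    rcases ho with ho | ho
    · exact absurd h (not_lt.2 ho)
    · exact le_antisymm hw.2 ho
  · refine Or.inl ⟨⟨hw, ?_⟩, fun h' => h.ne h'.2⟩
    rcases ho with ho | ho
    · exact le_antisymm hw.1 ho
    · exact absurd h (not_lt.2 ho)

theorem front_mem_disk1 {q : E3} (hf : q ∈ G.frontFace) (h0 : q 0 = -(G.s * G.h)) :
    q ∈ G.disk1 := by
  have hh := G.h_pos
  have hs := G.s_pos
  have hs1 := G.s_lt_one
  have hR := G.one_lt_R
  obtain ⟨⟨h1, h2⟩, h3⟩ := hf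
  have e : q 1 = -(1 - G.s) / 2 := by
    have : G.h * (q 1 * 2) = G.h * (-(1 - G.s)) := by rw [h0] at h3; linarith
    have := mul_left_cancel₀ hh.ne' this
    linarith
  have e2 : |q 2| ≤ 1 := by
    by_contra hc
    nlinarith [mul_lt_mul_of_pos_left (not_le.1 hc) hh]
  exact ⟨h0, by linarith, by linarith, by linarith⟩

theorem back_notMem_disk1 {q : E3} (hb : q ∈ G.backFace) (h0 : q 0 = -(G.s * G.h)) :
    q ∉ G.disk1 := by
  rintro ⟨-, -, h1, -⟩
  have hb2 := hb.2
  nlinarith [G.h_pos, G.s_lt_one]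

theorem top_mem_disk2 {q : E3} (hf : q ∈ G.topFace) (h0 : q 0 = G.s * G.h) :
    q ∈ G.disk2 := by
  have hh := G.h_pos
  have hs := G.s_pos
  have hs1 := G.s_lt_one
  have hR := G.one_lt_R
  obtain ⟨⟨h1, h2⟩, h3⟩ := hf
  have e : q 2 = (1 - G.s) / 2 := by
    have : G.h * (q 2 * 2) = G.h * (1 - G.s) := by rw [h0] at h3; linarith
    have := mul_left_cancel₀ hh.ne' this
    linarith
  have e2 : |q 1| ≤ 1 := by
    by_contra hc
    nlinarith [mul_lt_mul_of_pos_left (not_le.1 hc) hh]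
  exact ⟨h0, by linarith, by linarith, by linarith⟩

theorem bottom_notMem_disk2 {q : E3} (hb : q ∈ G.bottomFace) (h0 : q 0 = G.s * G.h) :
    q ∉ G.disk2 := by
  rintro ⟨-, -, h1, -⟩
  have hb2 := hb.2
  nlinarith [G.h_pos, G.s_lt_one]

/-! ### Local potentials -/

open Classical in
/-- The monodromy around every point off the removed curves is trivial: the sheets of the cells can
be renumbered, by the permutations `μ`, such that all walls through the point are crossed by the
identity. -/
theorem exists_potential {q : E3} (hq : q ∉ G.curves) :
    ∃ μ : Cell → Equiv.Perm (Fin 3), ∀ c d σ, q ∈ G.cellSet c → q ∈ G.cellSet d →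
      G.Crossing c d q σ → μ d = σ * μ c := by
  -- The permutations of the walls at `q`: `h0` and `h2` belong to the planes of the disks, and `v0`,
  -- `v1`, `v2`, `v3` to the boundary of the wedge in the four slabs.
  let h0 : Equiv.Perm (Fin 3) := if q ∈ G.disk1 then tr else 1
  let h2 : Equiv.Perm (Fin 3) := if q ∈ G.disk2 then tr else 1
  let v0 : Equiv.Perm (Fin 3) := if q ∈ G.frontFace then cyc⁻¹ else if q ∈ G.backFace then cyc else 1
  let v1 : Equiv.Perm (Fin 3) := if q ∈ G.frontFace ∪ G.backFace then cyc else 1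
  let v2 : Equiv.Perm (Fin 3) := if q ∈ G.topFace ∪ G.bottomFace then cyc⁻¹ else 1
  let v3 : Equiv.Perm (Fin 3) :=
    if q ∈ G.topFace then cyc else if q ∈ G.bottomFace then cyc⁻¹ else 1
  -- Where the boundary of the wedge meets one of the three planes, four cells come together, and the
  -- product of the permutations around this line is trivial. For the disks this is why the
  -- permutation of the front (top) face is replaced by its conjugate `tr * cyc * tr = cyc⁻¹` beyond
  -- the disk.
  have c0 : q ∈ G.wedge → q ∈ G.outside → q 0 = -(G.s * G.h) → v1 * h0 = h0 * v0 := by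
    intro hw ho hx
    by_cases hf : q ∈ G.frontFace
    · simp only [v1, h0, v0, hf, G.front_mem_disk1 hf hx, mem_union, true_or, if_true]
      decide
    by_cases hb : q ∈ G.backFace
    · simp [v1, h0, v0, hf, hb, G.back_notMem_disk1 hb hx]
    · simp [v1, h0, v0, hf, hb]
  have c1 : q ∈ G.wedge → q ∈ G.outside → v2 * cyc = v1 := by
    intro hw ho
    rcases G.boundary_cases hq hw ho with ⟨h1, h2⟩ | ⟨h1, h2⟩
    · simp only [v1, v2, h1, h2, if_true, if_false, one_mul]
    · simp only [v1, v2, h1, h2, if_true, if_false, inv_mul_cancel]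
  have c2 : q ∈ G.wedge → q ∈ G.outside → q 0 = G.s * G.h → v3 * h2 = h2 * v2 := by
    intro hw ho hx
    by_cases hf : q ∈ G.topFace
    · simp only [v3, h2, v2, hf, G.top_mem_disk2 hf hx, mem_union, true_or, if_true]
      decide
    by_cases hb : q ∈ G.bottomFace
    · simp [v3, h2, v2, hf, hb, G.bottom_notMem_disk2 hb hx]
    · simp [v3, h2, v2, hf, hb]
  -- Inside of the wedge, `μ` is the product of the permutations on the way from the leftmost cell.
  -- Outside, it is carried over through the boundary of the wedge if `q` lies on it; otherwise no
  -- inner cell contains `q`, and the outer cells can be numbered independently.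
  let μ : Cell → Equiv.Perm (Fin 3) := fun c => match c with
    | (true, 0) => 1
    | (true, 1) => h0
    | (true, 2) => cyc * h0
    | (true, 3) => h2 * (cyc * h0)
    | (false, 0) => if q ∈ G.wedge then v0 else 1
    | (false, 1) => if q ∈ G.wedge then v1 * h0 else h0
    | (false, 2) => if q ∈ G.wedge then v2 * (cyc * h0) else h0
    | (false, 3) => if q ∈ G.wedge then v3 * (h2 * (cyc * h0)) else h2 * h0
  refine ⟨μ, ?_⟩
  intro c d σ hc hd hσ
  cases hσ with
  | disk1 b _ hq1 =>
    cases b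
    · by_cases hw : q ∈ G.wedge
      · simp only [μ, hw, if_true]
        rw [c0 hw hc.1 hq1.1]; simp [h0, hq1]
      · simp [μ, hw, h0, hq1]
    · simp [μ, h0, hq1]
  | uncut1 b _ hq1 =>
    cases b
    · by_cases hw : q ∈ G.wedge
      · simp only [μ, hw, if_true]
        rw [c0 hw hc.1 (le_antisymm hc.2 hd.2.1)]; simp [h0, hq1]
      · simp [μ, hw, h0, hq1]
    · simp [μ, h0, hq1]
  | disk2 b _ hq1 =>
    cases b
    · by_cases hw : q ∈ G.wedge
      · simp only [μ, hw, if_true]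
        rw [← mul_assoc, c2 hw hc.1 hq1.1]; simp [h2, hq1, mul_assoc]
      · simp [μ, hw, h2, hq1]
    · simp [μ, h2, hq1]
  | uncut2 b _ hq1 =>
    cases b
    · by_cases hw : q ∈ G.wedge
      · simp only [μ, hw, if_true]
        rw [← mul_assoc, c2 hw hc.1 (le_antisymm hc.2.2 hd.2)]; simp [h2, hq1]
      · simp [μ, hw, h2, hq1]
    · simp [μ, h2, hq1]
  | square => rfl
  | uncutMid =>
    by_cases hw : q ∈ G.wedge
    · simp only [μ, hw, if_true]
      rw [← mul_assoc, c1 hw hc.1, one_mul]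
    · simp [μ, hw]
  | frontLeft _ hf => simp [μ, v0, hf, hf.1]
  | frontMid _ hf => simp [μ, v1, hf, hf.1]
  | back i hi _ hb =>
    have hf : q ∉ G.frontFace := fun hf => G.notMem_back_of_mem_front hq hf hb
    rcases hi with rfl | rfl
    · simp [μ, v0, hf, hb, hb.1]
    · simp [μ, v1, hb, hb.1]
  | uncutLeft i hi _ hn =>
    have hn' := hn
    simp only [mem_union, not_or] at hn'
    have hw : q ∈ G.wedge := hc.1
    rcases hi with rfl | rfl
    · simp [μ, v0, hn', hw]
    · simp only [μ, v1, hn, hw, if_true, if_false]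
  | topMid _ hf => simp [μ, v2, hf, hf.1]
  | topRight _ hf => simp [μ, v3, hf, hf.1]
  | bottom i hi _ hb =>
    have hf : q ∉ G.topFace := fun hf => G.notMem_bottom_of_mem_top hq hf hb
    rcases hi with rfl | rfl
    · simp [μ, v2, hb, hb.1]
    · simp [μ, v3, hf, hb, hb.1]
  | uncutRight i hi _ hn =>
    have hn' := hn
    simp only [mem_union, not_or] at hn'
    have hw : q ∈ G.wedge := hc.1
    rcases hi with rfl | rfl
    · simp only [μ, v2, hn, hw, if_true, if_false]
    · simp [μ, v3, hn', hw]

theorem isClosed_disk1 : IsClosed G.disk1 := by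
  change IsClosed ({q : E3 | q 0 = -(G.s * G.h)} ∩ ({q : E3 | -G.R ≤ q 1} ∩
    ({q : E3 | q 1 ≤ 0} ∩ {q : E3 | |q 2| ≤ G.R})))
  exact (isClosed_eq (by fun_prop) (by fun_prop)).inter
    ((isClosed_le (by fun_prop) (by fun_prop)).inter
    ((isClosed_le (by fun_prop) (by fun_prop)).inter (isClosed_le (by fun_prop) (by fun_prop))))

theorem isClosed_disk2 : IsClosed G.disk2 := by
  change IsClosed ({q : E3 | q 0 = G.s * G.h} ∩ ({q : E3 | |q 1| ≤ G.R} ∩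
    ({q : E3 | 0 ≤ q 2} ∩ {q : E3 | q 2 ≤ G.R})))
  exact (isClosed_eq (by fun_prop) (by fun_prop)).inter
    ((isClosed_le (by fun_prop) (by fun_prop)).inter
    ((isClosed_le (by fun_prop) (by fun_prop)).inter (isClosed_le (by fun_prop) (by fun_prop))))

theorem isClosed_frontFace : IsClosed G.frontFace :=
  G.isClosed_wedge.inter (s₂ := {q : E3 | 2 * G.h * q 1 = -(G.h + q 0)})
    (isClosed_eq (by fun_prop) (by fun_prop))

theorem isClosed_backFace : IsClosed G.backFace :=
  G.isClosed_wedge.inter (s₂ := {q : E3 | 2 * G.h * q 1 = G.h + q 0})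
    (isClosed_eq (by fun_prop) (by fun_prop))

theorem isClosed_topFace : IsClosed G.topFace :=
  G.isClosed_wedge.inter (s₂ := {q : E3 | 2 * G.h * q 2 = G.h - q 0})
    (isClosed_eq (by fun_prop) (by fun_prop))

theorem isClosed_bottomFace : IsClosed G.bottomFace :=
  G.isClosed_wedge.inter (s₂ := {q : E3 | 2 * G.h * q 2 = -(G.h - q 0)})
    (isClosed_eq (by fun_prop) (by fun_prop))

theorem eventually_mem_imp {X : Type*} [TopologicalSpace X] {A : Set X} (hA : IsClosed A) (q : X) :
    ∀ᶠ q' in 𝓝 q, q' ∈ A → q ∈ A := by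
  by_cases hq : q ∈ A
  · exact Filter.Eventually.of_forall fun _ _ => hq
  · filter_upwards [hA.isOpen_compl.mem_nhds hq] with q' hq' h
    exact absurd h hq'

/-- The perimeter of the first disk being removed, the disk is relatively open in its plane. -/
theorem eventually_mem_disk1 {q : E3} (hq : q ∉ G.curves) :
    ∀ᶠ q' : E3 in 𝓝 q, q ∈ G.disk1 → q' 0 = -(G.s * G.h) → q' ∈ G.disk1 := by
  by_cases hd : q ∈ G.disk1
  · have hw : ¬(q 1 = -G.R ∨ q 1 = 0 ∨ |q 2| = G.R) := fun h => hq (Or.inr (Or.inl ⟨hd, h⟩))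
    push Not at hw
    obtain ⟨w1, w2, w3⟩ := hw
    obtain ⟨-, d1, d2, d3⟩ := hd
    have c1 : Continuous fun q' : E3 => q' 1 := by fun_prop
    have c2 : Continuous fun q' : E3 => |q' 2| := by fun_prop
    filter_upwards [c1.continuousAt.eventually_const_lt (lt_of_le_of_ne d1 w1.symm),
      c1.continuousAt.eventually_lt_const (lt_of_le_of_ne d2 w2),
      c2.continuousAt.eventually_lt_const (lt_of_le_of_ne d3 w3)] with q' e1 e2 e3 _ e0
    exact ⟨e0, e1.le, e2.le, e3.le⟩
  · exact Filter.Eventually.of_forall fun _ h => absurd h hd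

/-- The perimeter of the second disk being removed, the disk is relatively open in its plane. -/
theorem eventually_mem_disk2 {q : E3} (hq : q ∉ G.curves) :
    ∀ᶠ q' : E3 in 𝓝 q, q ∈ G.disk2 → q' 0 = G.s * G.h → q' ∈ G.disk2 := by
  by_cases hd : q ∈ G.disk2
  · have hw : ¬(|q 1| = G.R ∨ q 2 = 0 ∨ q 2 = G.R) := fun h => hq (Or.inr (Or.inr ⟨hd, h⟩))
    push Not at hw
    obtain ⟨w1, w2, w3⟩ := hw
    obtain ⟨-, d1, d2, d3⟩ := hd
    have c1 : Continuous fun q' : E3 => |q' 1| := by fun_prop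
    have c2 : Continuous fun q' : E3 => q' 2 := by fun_prop
    filter_upwards [c1.continuousAt.eventually_lt_const (lt_of_le_of_ne d1 w1),
      c2.continuousAt.eventually_const_lt (lt_of_le_of_ne d2 w2.symm),
      c2.continuousAt.eventually_lt_const (lt_of_le_of_ne d3 w3)] with q' e1 e2 e3 _ e0
    exact ⟨e0, e1.le, e2.le, e3.le⟩
  · exact Filter.Eventually.of_forall fun _ h => absurd h hd

/-- The edges being removed, the front and back faces are relatively open in the boundary of the
wedge. -/
theorem eventually_mem_front_or_back {q : E3} (hq : q ∉ G.curves) :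
    ∀ᶠ q' : E3 in 𝓝 q, q ∈ G.frontFace ∪ G.backFace → q' ∈ G.wedge → q' ∈ G.outside →
      q' ∈ G.frontFace ∪ G.backFace := by
  by_cases hf : q ∈ G.frontFace ∪ G.backFace
  · obtain ⟨hw, he⟩ := G.mem_front_or_back.1 hf
    have hlt := (G.wedge_cases hq hw).resolve_left fun h => h.ne he
    have ho : IsOpen {q' : E3 | 2 * G.h * |q' 2| < G.h - q' 0} :=
      isOpen_lt (by fun_prop) (by fun_prop)
    filter_upwards [ho.mem_nhds hlt] with q' h' _ hw' ho'
    refine G.mem_front_or_back.2 ⟨hw', le_antisymm hw'.1 ?_⟩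
    exact ho'.resolve_right (not_le.2 h')
  · exact Filter.Eventually.of_forall fun _ h => absurd h hf

/-- The edges being removed, the top and bottom faces are relatively open in the boundary of the
wedge. -/
theorem eventually_mem_top_or_bottom {q : E3} (hq : q ∉ G.curves) :
    ∀ᶠ q' : E3 in 𝓝 q, q ∈ G.topFace ∪ G.bottomFace → q' ∈ G.wedge → q' ∈ G.outside →
      q' ∈ G.topFace ∪ G.bottomFace := by
  by_cases hf : q ∈ G.topFace ∪ G.bottomFace
  · obtain ⟨hw, he⟩ := G.mem_top_or_bottom.1 hf
    have hlt := (G.wedge_cases hq hw).resolve_right fun h => h.ne he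
    have ho : IsOpen {q' : E3 | 2 * G.h * |q' 1| < G.h + q' 0} :=
      isOpen_lt (by fun_prop) (by fun_prop)
    filter_upwards [ho.mem_nhds hlt] with q' h' _ hw' ho'
    refine G.mem_top_or_bottom.2 ⟨hw', le_antisymm hw'.2 ?_⟩
    exact ho'.resolve_left (not_le.2 h')
  · exact Filter.Eventually.of_forall fun _ h => absurd h hf

/-- The pattern of cells and walls near a point off the removed curves is a part of the pattern at
the point itself. -/
theorem eventually_crossing {q : E3} (hq : q ∉ G.curves) :
    ∀ᶠ q' in 𝓝 q, ∀ c d σ, q' ∈ G.cellSet c → q' ∈ G.cellSet d → G.Crossing c d q' σ →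
      q ∈ G.cellSet c ∧ q ∈ G.cellSet d ∧ G.Crossing c d q σ := by
  have hcell : ∀ᶠ q' in 𝓝 q, ∀ c, q' ∈ G.cellSet c → q ∈ G.cellSet c :=
    Filter.eventually_all.2 fun c => eventually_mem_imp (G.isClosed_cellSet c) q
  filter_upwards [hcell, eventually_mem_imp G.isClosed_disk1 q,
    eventually_mem_imp G.isClosed_disk2 q, eventually_mem_imp G.isClosed_frontFace q,
    eventually_mem_imp G.isClosed_backFace q, eventually_mem_imp G.isClosed_topFace q,
    eventually_mem_imp G.isClosed_bottomFace q, G.eventually_mem_disk1 hq,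
    G.eventually_mem_disk2 hq, G.eventually_mem_front_or_back hq,
    G.eventually_mem_top_or_bottom hq] with q' k kd1 kd2 kf kb kt kbo od1 od2 ofb otb
  intro c d σ hc hd hσ
  refine ⟨k c hc, k d hd, ?_⟩
  cases hσ with
  | disk1 b _ h => exact .disk1 b q (kd1 h)
  | uncut1 b _ h => exact .uncut1 b q fun h' => h (od1 h' (le_antisymm hc.2 hd.2.1))
  | disk2 b _ h => exact .disk2 b q (kd2 h)
  | uncut2 b _ h => exact .uncut2 b q fun h' => h (od2 h' (le_antisymm hc.2.2 hd.2))
  | square => exact .square q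
  | uncutMid => exact .uncutMid q
  | frontLeft _ h => exact .frontLeft q (kf h)
  | frontMid _ h => exact .frontMid q (kf h)
  | back i hi _ h => exact .back i hi q (kb h)
  | uncutLeft i hi _ h => exact .uncutLeft i hi q fun h' => h (ofb h' hc.1 hd.1)
  | topMid _ h => exact .topMid q (kt h)
  | topRight _ h => exact .topRight q (kt h)
  | bottom i hi _ h => exact .bottom i hi q (kbo h)
  | uncutRight i hi _ h => exact .uncutRight i hi q fun h' => h (otb h' hc.1 hd.1)

/-- Near every point of the base space the sheets of the cells can be renumbered such that the
pasting becomes trivial. -/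
theorem exists_local_potential (x : G.Base) :
    ∃ U : Set G.Base, IsOpen U ∧ x ∈ U ∧ ∃ μ : Cell → Equiv.Perm (Fin 3), ∀ x' ∈ U, ∀ c d σ,
      G.model x' ∈ G.cellSet c → G.model x' ∈ G.cellSet d → G.Crossing c d (G.model x') σ →
      μ d = σ * μ c := by
  obtain ⟨μ, hμ⟩ := G.exists_potential (G.model_notMem x)
  obtain ⟨V, hV, hVo, hxV⟩ := eventually_nhds_iff.1 (G.eventually_crossing (G.model_notMem x))
  refine ⟨G.model ⁻¹' V, hVo.preimage G.continuous_model, hxV, μ, fun x' hx' c d σ hc hd h => ?_⟩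
  obtain ⟨h1, h2, h3⟩ := hV _ hx' c d σ hc hd h
  exact hμ c d σ h1 h2 h3

/-! ### The covering map -/

open Classical in
/-- The number of the sheet of a point of the cover over `U`, after the renumbering `μ`. Off the
preimage of `U` it has no meaning. -/
def localSheet (U : Set G.Base) (μ : Cell → Equiv.Perm (Fin 3))
    (hμ : ∀ x' ∈ U, ∀ c d σ, G.model x' ∈ G.cellSet c → G.model x' ∈ G.cellSet d →
      G.Crossing c d (G.model x') σ → μ d = σ * μ c) : G.Cover → Fin 3 :=
  Quot.lift (fun u => if u.1.2.1 ∈ U then (μ u.1.1)⁻¹ u.1.2.2 else 0) <| by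
    rintro ⟨⟨c, x, i⟩, hc⟩ ⟨⟨d, y, j⟩, hd⟩ ⟨hxy, σ, hσ, hij⟩
    dsimp only at hxy hσ hij hc hd ⊢
    subst hxy
    by_cases hx : x ∈ U
    · rw [if_pos hx, if_pos hx, hμ x hx c d σ hc hd hσ, hij]
      simp
    · rw [if_neg hx, if_neg hx]

theorem isEvenlyCovered_proj (x : G.Base) : IsEvenlyCovered G.proj x (Fin 3) := by
  obtain ⟨U, hU, hxU, μ, hμ⟩ := G.exists_local_potential x
  have hmk : ∀ (x' : U) (j : Fin 3) (c d : Cell) (hc : G.model x' ∈ G.cellSet c)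
      (hd : G.model x' ∈ G.cellSet d), G.pt c x' (μ c j) hc = G.pt d x' (μ d j) hd :=
    fun x' j c d hc hd => G.pt_eq_pt (i := fun c => μ c j)
      (fun c d σ hc hd h => by rw [hμ x' x'.2 c d σ hc hd h]; rfl) c d hc hd
  obtain ⟨F, hF⟩ := G.exists_lift_of_closed_cover (T := U × Fin 3) (ι := Cell) (fun t => t.1.1)
    (by fun_prop) (fun c => {t | G.model t.1.1 ∈ G.cellSet c})
    (fun c => (G.isClosed_cellSet c).preimage
      (G.continuous_model.comp (continuous_subtype_val.comp continuous_fst)))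
    (fun t => G.exists_mem_cellSet _) id (fun c t => μ c t.2)
    (fun c => continuous_of_discreteTopology.comp continuous_snd) (fun c t h => h)
    (fun c d t hc hd => hmk t.1 t.2 c d hc hd)
  let L := G.localSheet U μ hμ
  have hL : ∀ c x' i hc, x' ∈ U → L (G.pt c x' i hc) = (μ c)⁻¹ i :=
    fun c x' i hc hx' => if_pos hx'
  have hFp : ∀ t, G.proj (F t) = t.1.1 := fun t => by
    obtain ⟨c, hc⟩ := G.exists_mem_cellSet (G.model t.1.1)
    rw [hF c t hc, proj_pt]
  have hFm : ∀ t, F t ∈ G.proj ⁻¹' U := fun t => by rw [mem_preimage, hFp]; exact t.1.2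
  have hLc : ContinuousOn L (G.proj ⁻¹' U) := by
    have hq : IsQuotientMap (Quot.mk G.Paste) := isQuotientMap_quot_mk
    rw [hq.continuousOn_isOpen_iff (hU.preimage G.continuous_proj)]
    have hc : Continuous fun u : G.CutSheets => (μ u.1.1)⁻¹ u.1.2.2 :=
      (continuous_of_discreteTopology (f := fun a : Cell × Fin 3 => (μ a.1)⁻¹ a.2)).comp
        (continuous_subtype_val.fst.prodMk continuous_subtype_val.snd.snd)
    exact hc.continuousOn.congr fun u hu => if_pos hu
  refine ⟨inferInstance, U, hxU, hU, hU.preimage G.continuous_proj,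
    { toFun := fun y => (⟨G.proj y, y.2⟩, L y)
      invFun := fun t => ⟨F t, hFm t⟩
      left_inv := ?_
      right_inv := ?_
      continuous_toFun := ?_
      continuous_invFun := F.continuous.subtype_mk hFm }, fun y => rfl⟩
  · rintro ⟨y, hy⟩
    obtain ⟨c, x', i, hc, rfl⟩ := G.exists_eq_pt y
    apply Subtype.ext
    change F (⟨x', hy⟩, L (G.pt c x' i hc)) = _
    rw [hF c _ hc]
    simp only [hL c x' i hc hy, id]
    exact congrArg (fun k => G.pt c x' k hc) ((μ c).apply_symm_apply i)
  · rintro ⟨x', j⟩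
    obtain ⟨c, hc⟩ := G.exists_mem_cellSet (G.model x'.1)
    refine Prod.ext (Subtype.ext (hFp _)) ?_
    change L (F (x', j)) = j
    rw [hF c _ hc]
    exact (hL c x' _ hc x'.2).trans ((μ c).symm_apply_apply j)
  · exact ((G.continuous_proj.comp continuous_subtype_val).subtype_mk _).prodMk
      hLc.domRestrict

theorem isCoveringMap_proj : IsCoveringMap G.proj :=
  fun x => (G.isEvenlyCovered_proj x).to_isEvenlyCovered_preimage

theorem card_fiber (x : G.Base) : Nat.card (G.proj ⁻¹' {x}) = 3 := by
  rw [← Nat.card_congr (G.isEvenlyCovered_proj x).fiberHomeomorph.toEquiv]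
  simp

theorem pt_injective {c : Cell} {x : G.Base} {i j : Fin 3} {hx : G.model x ∈ G.cellSet c}
    (h : G.pt c x i hx = G.pt c x j hx) : i = j := by
  obtain ⟨U, hU, hxU, μ, hμ⟩ := G.exists_local_potential x
  have h' := congrArg (G.localSheet U μ hμ) h
  have hL : ∀ i, G.localSheet U μ hμ (G.pt c x i hx) = (μ c)⁻¹ i := fun i => if_pos hxU
  rw [hL, hL] at h'
  exact (μ c)⁻¹.injective h'

/-! ### The lifts of the loop -/

theorem pt_congr {c : Cell} {x x' : G.Base} {i : Fin 3} (h : x = x')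
    (hx : G.model x ∈ G.cellSet c) (hx' : G.model x' ∈ G.cellSet c) :
    G.pt c x i hx = G.pt c x' i hx' := by
  subst h; rfl

@[simp] theorem model_loopA (t : unitInterval) : G.model (G.loopA t) = G.circleA t := by
  simp [model, loopA, pointA]

theorem circleA_one_lt (t : ℝ) : 1 < |G.circleA t 1| := by
  have hR := G.one_lt_R
  have h2 := Real.neg_one_le_cos (2 * Real.pi * t)
  have : G.circleA t 1 < -1 := by
    simp [circleA]
    nlinarith
  rw [abs_of_neg (by linarith)]
  linarith

theorem circleA_mem_outside (t : ℝ) : G.circleA t ∈ G.outside := by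
  have hh := G.h_pos
  have h1 := mul_lt_mul_of_pos_left (G.circleA_one_lt t) hh
  have h2 : |G.circleA t 2| = 1 / 2 := by
    simp [circleA, abs_of_pos]
  rcases le_total (G.circleA t 0) 0 with h | h
  · exact Or.inl (by linarith)
  · exact Or.inr (by rw [h2]; linarith)

theorem circleA_notMem_wedge (t : ℝ) : G.circleA t ∉ G.wedge := by
  rintro ⟨h1, h2⟩
  have hh := G.h_pos
  have h1' := mul_lt_mul_of_pos_left (G.circleA_one_lt t) hh
  have h3 : |G.circleA t 2| = 1 / 2 := by
    simp [circleA, abs_of_pos]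
  rw [h3] at h2
  linarith

theorem circleA_notMem_disk2 (t : ℝ) : G.circleA t ∉ G.disk2 := by
  rintro ⟨-, -, h3, -⟩
  simp [circleA] at h3
  norm_num at h3

/-- During its first half the circle is on the right of the plane of the first disk. -/
theorem circleA_zero_ge {t : ℝ} (h0 : 0 ≤ t) (h1 : t ≤ 1 / 2) :
    -(G.s * G.h) ≤ G.circleA t 0 := by
  have hR := G.one_lt_R
  have hsin : 0 ≤ Real.sin (2 * Real.pi * t) :=
    Real.sin_nonneg_of_nonneg_of_le_pi (by positivity) (by nlinarith [Real.pi_pos])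
  simp [circleA]
  have : 0 ≤ (G.R - 1) / 2 := by linarith
  positivity

/-- During its second half the circle is on the left of the plane of the first disk. -/
theorem circleA_zero_le {t : ℝ} (h0 : 1 / 2 ≤ t) (h1 : t ≤ 1) :
    G.circleA t 0 ≤ -(G.s * G.h) := by
  have hR := G.one_lt_R
  have hsin : 0 ≤ Real.sin (2 * Real.pi * t - Real.pi) :=
    Real.sin_nonneg_of_nonneg_of_le_pi (by nlinarith [Real.pi_pos]) (by nlinarith [Real.pi_pos])
  rw [Real.sin_sub_pi] at hsin
  simp [circleA]
  have : 0 ≤ (G.R - 1) / 2 := by linarith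
  nlinarith

theorem circleA_half_zero : G.circleA (1 / 2) 0 = -(G.s * G.h) := by
  have : 2 * Real.pi * 2⁻¹ = Real.pi := by ring
  simp [circleA, this]

theorem circleA_half_mem_disk1 : G.circleA (1 / 2) ∈ G.disk1 := by
  have hR := G.one_lt_R
  have : 2 * Real.pi * 2⁻¹ = Real.pi := by ring
  refine ⟨G.circleA_half_zero, ?_, ?_, ?_⟩
  · simp [circleA, this]; linarith
  · simp [circleA, this]; linarith
  · have h3 : |G.circleA (1 / 2) 2| = 1 / 2 := by
      simp [circleA, abs_of_pos]
    rw [h3]; linarith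

theorem circleA_notMem_disk1 {t : ℝ} (h0 : 0 ≤ t) (h1 : t < 1 / 2) : G.circleA t ∉ G.disk1 := by
  have hR := G.one_lt_R
  rintro ⟨h2, h3, -⟩
  have hs : Real.sin (2 * Real.pi * t) = 0 := by
    simp [circleA] at h2
    rcases h2 with h2 | h2
    · linarith
    · exact h2
  have hc : Real.cos (2 * Real.pi * t) ≤ 0 := by
    simp [circleA] at h3
    nlinarith
  have hc1 : Real.cos Real.pi < Real.cos (2 * Real.pi * t) :=
    Real.cos_lt_cos_of_nonneg_of_le_pi (by positivity) le_rfl (by nlinarith [Real.pi_pos])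
  rw [Real.cos_pi] at hc1
  have := Real.sin_sq_add_cos_sq (2 * Real.pi * t)
  rw [hs] at this
  nlinarith

/-- The lift of the loop `a` from sheet `k`: it stays on sheet `k` until the loop goes through the
first disk, and then on sheet `tr k`. -/
theorem exists_lift_loopA (k : Fin 3) : ∃ Γ : C(unitInterval, G.Cover),
    (∀ t, G.proj (Γ t) = G.loopA t) ∧ Γ 0 = G.sheetPoint k ∧ Γ 1 = G.sheetPoint (tr k) := by
  have hpos := mul_pos G.s_pos G.h_pos
  let A : Fin 4 → Set unitInterval := fun j =>
    {t | G.circleA t ∈ G.slab j} ∩ (if j = 0 then {t | 1 / 2 ≤ (t : ℝ)} else {t | (t : ℝ) ≤ 1 / 2})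
  let S : Fin 4 → Fin 3 := fun j => if j = 0 then tr k else k
  have hcont : Continuous fun t : unitInterval => G.circleA t := by
    have := G.continuous_model.comp G.loopA.continuous
    exact this.congr fun t => G.model_loopA t
  have hA : ∀ j, IsClosed (A j) := by
    intro j
    refine ((G.isClosed_slab j).preimage hcont).inter ?_
    split_ifs
    · exact isClosed_le (by fun_prop) (by fun_prop)
    · exact isClosed_le (by fun_prop) (by fun_prop)
  have hcov : ∀ t, ∃ j, t ∈ A j := by
    intro t
    rcases le_total (1 / 2) (t : ℝ) with h | h
    · exact ⟨0, G.circleA_zero_le h t.2.2, by simpa using h⟩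
    · have h0 := G.circleA_zero_ge t.2.1 h
      by_cases h1 : G.circleA t 0 ≤ 0
      · exact ⟨1, ⟨h0, h1⟩, by simpa using h⟩
      by_cases h2 : G.circleA t 0 ≤ G.s * G.h
      · exact ⟨2, ⟨(not_le.1 h1).le, h2⟩, by simpa using h⟩
      · exact ⟨3, (not_le.1 h2).le, by simpa using h⟩
  have hmem : ∀ j, ∀ t ∈ A j, G.model (G.loopA t) ∈ G.cellSet (false, j) := by
    intro j t ht
    rw [model_loopA]
    exact ⟨G.circleA_mem_outside t, ht.1⟩
  have hag : ∀ m n t (hm : t ∈ A m) (hn : t ∈ A n),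
      G.pt (false, m) (G.loopA t) (S m) (hmem m t hm) =
        G.pt (false, n) (G.loopA t) (S n) (hmem n t hn) := by
    intro m n t hm hn
    rcases lt_trichotomy (t : ℝ) (1 / 2) with ht | ht | ht
    · -- The loop has not yet met the disk, and all walls that it meets are uncut.
      have hS : ∀ j, t ∈ A j → S j = k := by
        intro j hj
        have : j ≠ 0 := by
          rintro rfl
          have := hj.2
          simp at this
          linarith
        simp [S, this]
      rw! [hS m hm, hS n hn]
      refine G.pt_eq_pt (i := fun _ => k) ?_ _ _ _ _
      rw [model_loopA]
      intro c d σ hc hd h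
      cases h with
      | disk1 b _ hq => exact absurd hq (G.circleA_notMem_disk1 t.2.1 ht)
      | disk2 b _ hq => exact absurd hq (G.circleA_notMem_disk2 t)
      | uncut1 => rfl
      | uncut2 => rfl
      | uncutMid => rfl
      | _ => exact absurd hc.1 (G.circleA_notMem_wedge t)
    · -- The loop goes through the disk.
      have e0 : G.circleA t 0 = -(G.s * G.h) := by rw [ht]; exact G.circleA_half_zero
      have e1 : G.circleA t ∈ G.disk1 := by rw [ht]; exact G.circleA_half_mem_disk1
      refine G.pt_eq_pt (i := fun c => S c.2) ?_ _ _ _ _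
      rw [model_loopA]
      intro c d σ hc hd h
      cases h with
      | disk1 b _ hq => simp [S]
      | uncut1 b _ hq => exact absurd e1 hq
      | disk2 b _ hq => exact absurd hq (G.circleA_notMem_disk2 t)
      | uncut2 b _ hq => rfl
      | uncutMid => rfl
      | _ => exact absurd hc.1 (G.circleA_notMem_wedge t)
    · have hS : ∀ j, t ∈ A j → j = 0 := by
        intro j hj
        by_contra hne
        have := hj.2
        rw [if_neg hne] at this
        exact absurd ht (not_lt.2 this)
      obtain rfl := hS m hm
      obtain rfl := hS n hn
      rfl
  obtain ⟨Γ, hΓ⟩ := G.exists_lift_of_closed_cover G.loopA G.loopA.continuous A hA hcov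
    (fun j => (false, j)) (fun j _ => S j) (fun _ => continuous_const) hmem hag
  have h0 : (0 : unitInterval) ∈ A 1 := by
    refine ⟨⟨G.circleA_zero_ge le_rfl (by norm_num), ?_⟩, ?_⟩
    · simp [circleA]; exact hpos.le
    · simp
  have h1 : (1 : unitInterval) ∈ A 0 := by
    refine ⟨G.circleA_zero_le (by norm_num) le_rfl, ?_⟩
    simp; norm_num
  refine ⟨Γ, fun t => ?_, ?_, ?_⟩
  · obtain ⟨j, hj⟩ := hcov t
    rw [hΓ j t hj, proj_pt]
  · rw [hΓ 1 0 h0]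
    have hb : G.model G.basePoint = G.circleA 0 := by
      rw [← G.loopA.source, model_loopA]; rfl
    have hm : G.model G.basePoint ∈ G.cellSet (false, 1) := by
      rw [hb]; exact ⟨G.circleA_mem_outside 0, h0.1⟩
    refine (G.pt_congr G.loopA.source _ hm).trans ?_
    refine (G.pt_eq_of_crossing G.model_basePoint_mem hm (.uncut1 false _ ?_) rfl).symm
    rw [hb]
    exact G.circleA_notMem_disk1 le_rfl (by norm_num)
  · rw [hΓ 0 1 h1]
    exact G.pt_congr G.loopA.target _ G.model_basePoint_mem

theorem sheetPoint_injective : Function.Injective G.sheetPoint := fun _ _ h => G.pt_injective h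

/-! ### Convex pieces of the cells -/

/-- `I` consists of points of `K` from which `K` is seen through `I`: every segment from a point of
`K` to a point of `I` lies in `I`, with the possible exception of its first point. This is the
relation between a convex set `K` that is given by weak inequalities and the set `I` that is given
by the corresponding strict ones. -/
def IsCore (K I : Set E3) : Prop :=
  I ⊆ K ∧ ∀ q ∈ K, ∀ p ∈ I, ∀ a b : ℝ, 0 ≤ a → 0 < b → a + b = 1 → a • q + b • p ∈ I

theorem IsCore.inter {K I K' I' : Set E3} (h : IsCore K I) (h' : IsCore K' I') :
    IsCore (K ∩ K') (I ∩ I') :=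
  ⟨inter_subset_inter h.1 h'.1, fun q hq p hp a b ha hb hab =>
    ⟨h.2 q hq.1 p hp.1 a b ha hb hab, h'.2 q hq.2 p hp.2 a b ha hb hab⟩⟩

/-- A closed half-space, whose core is the open half-space. -/
theorem isCore_halfSpace (u v w e : ℝ) :
    IsCore {q : E3 | 0 ≤ u * q 0 + v * q 1 + w * q 2 + e}
      {q : E3 | 0 < u * q 0 + v * q 1 + w * q 2 + e} := by
  refine ⟨fun q hq => by rw [mem_ofPred_eq] at hq ⊢; exact hq.le, fun q hq p hp a b ha hb hab => ?_⟩
  have hq' : 0 ≤ u * q 0 + v * q 1 + w * q 2 + e := hq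
  have hp' : 0 < u * p 0 + v * p 1 + w * p 2 + e := hp
  change 0 < u * (a • q + b • p) 0 + v * (a • q + b • p) 1 + w * (a • q + b • p) 2 + e
  have : u * (a • q + b • p) 0 + v * (a • q + b • p) 1 + w * (a • q + b • p) 2 + e =
      a * (u * q 0 + v * q 1 + w * q 2 + e) + b * (u * p 0 + v * p 1 + w * p 2 + e) := by
    have he : e = (a + b) * e := by rw [hab, one_mul]
    simp only [PiLp.add_apply, PiLp.smul_apply, smul_eq_mul]
    linear_combination he
  rw [this]
  have h1 := mul_nonneg ha hq'
  have h2 := mul_pos hb hp'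
  linarith

/-- The open slabs. -/
def openSlab (i : Fin 4) : Set E3 :=
  match i with
    | 0 => {q | q 0 < -(G.s * G.h)}
    | 1 => {q | -(G.s * G.h) < q 0 ∧ q 0 < 0}
    | 2 => {q | 0 < q 0 ∧ q 0 < G.s * G.h}
    | 3 => {q | G.s * G.h < q 0}

theorem isCore_slab (i : Fin 4) : IsCore (G.slab i) (G.openSlab i) := by
  have h1 : ∀ e : ℝ, IsCore {q : E3 | e ≤ q 0} {q | e < q 0} := fun e => by
    convert isCore_halfSpace 1 0 0 (-e) using 3 <;> simp
  have h2 : ∀ e : ℝ, IsCore {q : E3 | q 0 ≤ e} {q | q 0 < e} := fun e => by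
    convert isCore_halfSpace (-1) 0 0 e using 3 <;> simp
  fin_cases i
  · exact h2 _
  · exact (h1 _).inter (h2 _)
  · exact (h1 _).inter (h2 _)
  · exact h1 _

theorem openSlab_disjoint_wires {i : Fin 4} {q : E3} (hq : q ∈ G.openSlab i) :
    q ∉ G.wire1 ∪ G.wire2 := by
  have hpos := mul_pos G.s_pos G.h_pos
  have h : q 0 ≠ -(G.s * G.h) ∧ q 0 ≠ G.s * G.h := by
    fin_cases i
    · have : q 0 < -(G.s * G.h) := hq
      exact ⟨this.ne, by linarith⟩
    · obtain ⟨h1, h2⟩ : -(G.s * G.h) < q 0 ∧ q 0 < 0 := hq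
      exact ⟨h1.ne', by linarith⟩
    · obtain ⟨h1, h2⟩ : 0 < q 0 ∧ q 0 < G.s * G.h := hq
      exact ⟨by linarith, h2.ne⟩
    · have : G.s * G.h < q 0 := hq
      exact ⟨by linarith, this.ne'⟩
  rintro (hw | hw)
  · exact h.1 hw.1.1
  · exact h.2 hw.1.1

/-- A convex piece of a cell whose core avoids the removed curves is connected by segments. -/
theorem joined_of_isCore {K I : Set E3} {c : Cell} (hKI : IsCore K I) (hK : K ⊆ G.cellSet c)
    (hI : ∀ q ∈ I, q ∉ G.curves) (x x' : G.Base) (i : Fin 3) (hx : G.model x ∈ K)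
    (hx' : G.model x' ∈ I) :
    Joined (G.pt c x i (hK hx)) (G.pt c x' i (hK (hKI.1 hx'))) := by
  let γ : unitInterval → E3 := fun t => (1 - (t : ℝ)) • G.model x + (t : ℝ) • G.model x'
  have hγ : Continuous γ := by fun_prop
  have h0 : γ 0 = G.model x := by simp [γ]
  have h1 : γ 1 = G.model x' := by simp [γ]
  have hpos : ∀ t : unitInterval, t ≠ 0 → γ t ∈ I := fun t ht =>
    hKI.2 _ hx _ hx' _ _ (sub_nonneg.2 t.2.2) (lt_of_le_of_ne t.2.1 fun h => ht (Subtype.ext h.symm))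
      (by ring)
  have hn : ∀ t, γ t ∉ G.curves := fun t => by
    by_cases ht : t = 0
    · rw [ht, h0]; exact G.model_notMem x
    · exact hI _ (hpos t ht)
  have hc : ∀ t, γ t ∈ G.cellSet c := fun t => by
    by_cases ht : t = 0
    · rw [ht, h0]; exact hK hx
    · exact hK (hKI.1 (hpos t ht))
  have e : ∀ t x (h : γ t = G.model x), G.ofModel (γ t) (hn t) = x := fun t x h => by
    rw [← G.ofModel_model x]
    congr 1
  refine ⟨⟨⟨fun t => G.pt c (G.ofModel (γ t) (hn t)) i (by simpa using hc t), ?_⟩, ?_, ?_⟩⟩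
  · refine continuous_quot_mk.comp (Continuous.subtype_mk ?_ _)
    exact continuous_const.prodMk
      (((G.Φ.continuous.comp hγ).subtype_mk _).prodMk continuous_const)
  · exact G.pt_congr (e 0 x h0) _ _
  · exact G.pt_congr (e 1 x' h1) _ _

/-- A first coordinate in the interior of a slab and strictly between `-h` and `h`, so that the plane
with this coordinate meets the interior of the wedge. -/
def slabX (j : Fin 4) : ℝ :=
  match j with
    | 0 => -((1 + G.s) * G.h / 2)
    | 1 => -(G.s * G.h / 2)
    | 2 => G.s * G.h / 2
    | 3 => (1 + G.s) * G.h / 2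

theorem slabX_bounds (j : Fin 4) : -G.h < G.slabX j ∧ G.slabX j < G.h := by
  have hh := G.h_pos
  have hs := G.s_pos
  have hs1 := G.s_lt_one
  have hpos := mul_pos hs hh
  have h2 : G.s * G.h < G.h := by nlinarith
  fin_cases j <;> simp only [slabX] <;> constructor <;> linarith

theorem mem_openSlab_of_eq {j : Fin 4} {q : E3} (h : q 0 = G.slabX j) : q ∈ G.openSlab j := by
  have hh := G.h_pos
  have hs1 := G.s_lt_one
  have hpos := mul_pos G.s_pos hh
  have h2 : G.s * G.h < G.h := by nlinarith
  fin_cases j <;> simp only [slabX] at h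
  · change q 0 < _; linarith
  · change _ < q 0 ∧ q 0 < _; constructor <;> linarith
  · change _ < q 0 ∧ q 0 < _; constructor <;> linarith
  · change _ < q 0; linarith

/-- The wires lie in the planes that separate the slabs, so in an open slab only edges are removed. -/
theorem notMem_curves_of_openSlab {j : Fin 4} {q : E3} (hj : q ∈ G.openSlab j)
    (he : q ∉ G.edges) : q ∉ G.curves := by
  rintro (h | h)
  · exact he h
  · exact G.openSlab_disjoint_wires hj h

/-- The interior of the wedge. -/
def openWedge : Set E3 := {q | 2 * G.h * |q 1| < G.h + q 0 ∧ 2 * G.h * |q 2| < G.h - q 0}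

theorem isCore_wedge : IsCore G.wedge G.openWedge := by
  have k := ((isCore_halfSpace 1 (2 * G.h) 0 G.h).inter (isCore_halfSpace 1 (-(2 * G.h)) 0 G.h)).inter
    ((isCore_halfSpace (-1) 0 (2 * G.h) G.h).inter (isCore_halfSpace (-1) 0 (-(2 * G.h)) G.h))
  have hh : |2 * G.h| = 2 * G.h := abs_of_pos (by linarith [G.h_pos])
  have e : ∀ y : ℝ, 2 * G.h * |y| = |2 * G.h * y| := fun y => by rw [abs_mul, hh]
  convert k using 1
  · ext q
    simp only [wedge, e, abs_le, mem_inter_iff, mem_ofPred_eq]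
    constructor
    · rintro ⟨⟨h1, h2⟩, h3, h4⟩
      refine ⟨⟨?_, ?_⟩, ?_, ?_⟩ <;> linarith
    · rintro ⟨⟨h1, h2⟩, h3, h4⟩
      refine ⟨⟨?_, ?_⟩, ?_, ?_⟩ <;> linarith
  · ext q
    simp only [openWedge, e, abs_lt, mem_inter_iff, mem_ofPred_eq]
    constructor
    · rintro ⟨⟨h1, h2⟩, h3, h4⟩
      refine ⟨⟨?_, ?_⟩, ?_, ?_⟩ <;> linarith
    · rintro ⟨⟨h1, h2⟩, h3, h4⟩
      refine ⟨⟨?_, ?_⟩, ?_, ?_⟩ <;> linarith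

theorem openWedge_disjoint_edges {q : E3} (hq : q ∈ G.openWedge) : q ∉ G.edges := by
  intro he
  have hh := G.h_pos
  have h1 : 0 ≤ 2 * G.h * |q 1| := by positivity
  have h2 : 0 ≤ 2 * G.h * |q 2| := by positivity
  obtain ⟨k1, k2⟩ := hq
  rcases (G.edges_sub he).2 with ⟨h, -⟩ | h | h <;> linarith

theorem compl_wedge_disjoint_edges {q : E3} (hq : q ∉ G.wedge) : q ∉ G.edges :=
  fun h => hq (G.edges_sub h).1

/-- A point in the interior of a cell inside of the wedge. -/
def innerCenter (j : Fin 4) : E3 := !₂[G.slabX j, 0, 0]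

theorem innerCenter_mem (j : Fin 4) : G.innerCenter j ∈ G.openWedge ∩ G.openSlab j := by
  refine ⟨?_, G.mem_openSlab_of_eq (by simp [innerCenter])⟩
  have := G.slabX_bounds j
  constructor <;> simp [innerCenter] <;> linarith

theorem innerCenter_notMem (j : Fin 4) : G.innerCenter j ∉ G.curves :=
  G.notMem_curves_of_openSlab (G.innerCenter_mem j).2
    (G.openWedge_disjoint_edges (G.innerCenter_mem j).1)

theorem innerCenter_mem_cellSet (j : Fin 4) : G.innerCenter j ∈ G.cellSet (true, j) :=
  ⟨G.isCore_wedge.1 (G.innerCenter_mem j).1, (G.isCore_slab j).1 (G.innerCenter_mem j).2⟩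

theorem joined_innerCenter (j : Fin 4) (x : G.Base) (i : Fin 3)
    (hx : G.model x ∈ G.cellSet (true, j)) :
    Joined (G.pt _ x i hx) (G.pt (true, j) (G.ofModel _ (G.innerCenter_notMem j)) i
      (by simpa using G.innerCenter_mem_cellSet j)) :=
  G.joined_of_isCore (G.isCore_wedge.inter (G.isCore_slab j)) subset_rfl
    (fun _ hq => G.notMem_curves_of_openSlab hq.2 (G.openWedge_disjoint_edges hq.1)) _ _ _ hx
    (by simpa using G.innerCenter_mem j)

/-- A point in a slab, far away from the wedge in both of the other directions. The signs `ε`, `δ`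
select one of the four directions. -/
def corner (j : Fin 4) (ε δ : ℝ) : E3 := !₂[G.slabX j, ε * (G.R + 1), δ * (G.R + 1)]

/-- The part of the outside of the wedge in front (`ε = -1`) or in the back (`ε = 1`) of it. -/
theorem isCore_outsideY (ε : ℝ) : IsCore {q : E3 | G.h + q 0 ≤ 2 * G.h * (ε * q 1)}
    {q : E3 | G.h + q 0 < 2 * G.h * (ε * q 1)} := by
  convert isCore_halfSpace (-1) (2 * G.h * ε) 0 (-G.h) using 1
  · ext q; simp only [mem_ofPred_eq]; constructor <;> intro h <;> linarith
  · ext q; simp only [mem_ofPred_eq]; constructor <;> intro h <;> linarith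

/-- The part of the outside of the wedge above (`δ = 1`) or below (`δ = -1`) it. -/
theorem isCore_outsideZ (δ : ℝ) : IsCore {q : E3 | G.h - q 0 ≤ 2 * G.h * (δ * q 2)}
    {q : E3 | G.h - q 0 < 2 * G.h * (δ * q 2)} := by
  convert isCore_halfSpace 1 0 (2 * G.h * δ) (-G.h) using 1
  · ext q; simp only [mem_ofPred_eq]; constructor <;> intro h <;> linarith
  · ext q; simp only [mem_ofPred_eq]; constructor <;> intro h <;> linarith

theorem sign_mul_le_abs {ε : ℝ} (hε : ε = 1 ∨ ε = -1) (y : ℝ) : ε * y ≤ |y| := by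
  rcases hε with rfl | rfl
  · simpa using le_abs_self y
  · simpa using neg_le_abs y

theorem sign_mul_self {ε : ℝ} (hε : ε = 1 ∨ ε = -1) : ε * ε = 1 := by
  rcases hε with rfl | rfl <;> norm_num

theorem corner_memY (j : Fin 4) {ε : ℝ} (δ : ℝ) (hε : ε = 1 ∨ ε = -1) :
    G.h + G.corner j ε δ 0 < 2 * G.h * (ε * G.corner j ε δ 1) := by
  have h := G.slabX_bounds j
  have : ε * (ε * (G.R + 1)) = G.R + 1 := by rw [← mul_assoc, sign_mul_self hε, one_mul]
  simp [corner, this]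
  nlinarith [G.h_pos, G.one_lt_R]

theorem corner_memZ (j : Fin 4) (ε : ℝ) {δ : ℝ} (hδ : δ = 1 ∨ δ = -1) :
    G.h - G.corner j ε δ 0 < 2 * G.h * (δ * G.corner j ε δ 2) := by
  have h := G.slabX_bounds j
  have : δ * (δ * (G.R + 1)) = G.R + 1 := by rw [← mul_assoc, sign_mul_self hδ, one_mul]
  simp [corner, this]
  nlinarith [G.h_pos, G.one_lt_R]

theorem outsideY_sub {ε : ℝ} (hε : ε = 1 ∨ ε = -1) {q : E3}
    (h : G.h + q 0 ≤ 2 * G.h * (ε * q 1)) : q ∈ G.outside :=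
  Or.inl (h.trans (mul_le_mul_of_nonneg_left (sign_mul_le_abs hε _) (by linarith [G.h_pos])))

theorem outsideZ_sub {δ : ℝ} (hδ : δ = 1 ∨ δ = -1) {q : E3}
    (h : G.h - q 0 ≤ 2 * G.h * (δ * q 2)) : q ∈ G.outside :=
  Or.inr (h.trans (mul_le_mul_of_nonneg_left (sign_mul_le_abs hδ _) (by linarith [G.h_pos])))

theorem openOutsideY_notMem_wedge {ε : ℝ} (hε : ε = 1 ∨ ε = -1) {q : E3}
    (h : G.h + q 0 < 2 * G.h * (ε * q 1)) : q ∉ G.wedge := fun hw =>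
  absurd (h.trans_le (mul_le_mul_of_nonneg_left (sign_mul_le_abs hε _) (by linarith [G.h_pos])))
    (not_lt.2 hw.1)

theorem openOutsideZ_notMem_wedge {δ : ℝ} (hδ : δ = 1 ∨ δ = -1) {q : E3}
    (h : G.h - q 0 < 2 * G.h * (δ * q 2)) : q ∉ G.wedge := fun hw =>
  absurd (h.trans_le (mul_le_mul_of_nonneg_left (sign_mul_le_abs hδ _) (by linarith [G.h_pos])))
    (not_lt.2 hw.2)

theorem corner_mem_openSlab (j : Fin 4) (ε δ : ℝ) : G.corner j ε δ ∈ G.openSlab j :=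
  G.mem_openSlab_of_eq (by simp [corner])

theorem corner_notMem (j : Fin 4) {ε : ℝ} (δ : ℝ) (hε : ε = 1 ∨ ε = -1) :
    G.corner j ε δ ∉ G.curves :=
  G.notMem_curves_of_openSlab (G.corner_mem_openSlab j ε δ)
    (G.compl_wedge_disjoint_edges (G.openOutsideY_notMem_wedge hε (G.corner_memY j δ hε)))

theorem corner_mem_cellSet (j : Fin 4) {ε : ℝ} (δ : ℝ) (hε : ε = 1 ∨ ε = -1) :
    G.corner j ε δ ∈ G.cellSet (false, j) :=
  ⟨G.outsideY_sub hε (G.corner_memY j δ hε).le, (G.isCore_slab j).1 (G.corner_mem_openSlab j ε δ)⟩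

/-- The point of the cover over a corner, on a given sheet of the outer cell. -/
def cornerPt (j : Fin 4) {ε : ℝ} (δ : ℝ) (hε : ε = 1 ∨ ε = -1) (i : Fin 3) : G.Cover :=
  G.pt (false, j) (G.ofModel _ (G.corner_notMem j δ hε)) i
    (by simpa using G.corner_mem_cellSet j δ hε)

theorem joined_cornerY (j : Fin 4) {ε : ℝ} (δ : ℝ) (hε : ε = 1 ∨ ε = -1) (x : G.Base) (i : Fin 3)
    (hx : G.model x ∈ G.cellSet (false, j))
    (h : G.h + G.model x 0 ≤ 2 * G.h * (ε * G.model x 1)) :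
    Joined (G.pt _ x i hx) (G.cornerPt j δ hε i) :=
  G.joined_of_isCore (c := (false, j)) ((G.isCore_outsideY ε).inter (G.isCore_slab j))
    (fun _ hq => ⟨G.outsideY_sub hε hq.1, hq.2⟩)
    (fun _ hq => G.notMem_curves_of_openSlab hq.2
      (G.compl_wedge_disjoint_edges (G.openOutsideY_notMem_wedge hε hq.1))) _ _ _ ⟨h, hx.2⟩
    (by simpa using ⟨G.corner_memY j δ hε, G.corner_mem_openSlab j ε δ⟩)

theorem joined_cornerZ (j : Fin 4) {ε δ : ℝ} (hε : ε = 1 ∨ ε = -1) (hδ : δ = 1 ∨ δ = -1)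
    (x : G.Base) (i : Fin 3) (hx : G.model x ∈ G.cellSet (false, j))
    (h : G.h - G.model x 0 ≤ 2 * G.h * (δ * G.model x 2)) :
    Joined (G.pt _ x i hx) (G.cornerPt j δ hε i) :=
  G.joined_of_isCore (c := (false, j)) ((G.isCore_outsideZ δ).inter (G.isCore_slab j))
    (fun _ hq => ⟨G.outsideZ_sub hδ hq.1, hq.2⟩)
    (fun _ hq => G.notMem_curves_of_openSlab hq.2
      (G.compl_wedge_disjoint_edges (G.openOutsideZ_notMem_wedge hδ hq.1))) _ _ _ ⟨h, hx.2⟩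
    (by simpa using ⟨G.corner_memZ j ε hδ, G.corner_mem_openSlab j ε δ⟩)

/-- The point of the cover over the upper back corner of a slab, on a given sheet of the outer
cell. -/
def outerPt (j : Fin 4) (i : Fin 3) : G.Cover := G.cornerPt j (ε := 1) 1 (Or.inl rfl) i

/-- The outer cells are covered by four half-spaces, and neighbouring ones have a corner in
common. -/
theorem joined_outerPt (j : Fin 4) (x : G.Base) (i : Fin 3)
    (hx : G.model x ∈ G.cellSet (false, j)) : Joined (G.pt _ x i hx) (G.outerPt j i) := by
  have hY : ∀ (x : G.Base) (hx : G.model x ∈ G.cellSet (false, j)),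
      G.h + G.model x 0 ≤ 2 * G.h * |G.model x 1| → Joined (G.pt _ x i hx) (G.outerPt j i) := by
    intro x hx h
    rcases le_total 0 (G.model x 1) with k | k
    · rw [abs_of_nonneg k] at h
      exact G.joined_cornerY j 1 (Or.inl rfl) x i hx (by simpa using h)
    · rw [abs_of_nonpos k] at h
      refine (G.joined_cornerY j 1 (Or.inr rfl) x i hx (by simpa using h)).trans ?_
      refine G.joined_cornerZ j (Or.inl rfl) (Or.inl rfl) _ i _ ?_
      rw [model_ofModel]
      exact (G.corner_memZ j _ (Or.inl rfl)).le
  rcases hx.1 with h | h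
  · exact hY x hx h
  · rcases le_total 0 (G.model x 2) with k | k
    · rw [abs_of_nonneg k] at h
      exact G.joined_cornerZ j (Or.inl rfl) (Or.inl rfl) x i hx (by simpa using h)
    · rw [abs_of_nonpos k] at h
      refine (G.joined_cornerZ j (ε := 1) (Or.inl rfl) (Or.inr rfl) x i hx
        (by simpa using h)).trans ?_
      refine hY _ _ ?_
      rw [model_ofModel]
      refine (G.corner_memY j _ (Or.inl rfl)).le.trans ?_
      exact mul_le_mul_of_nonneg_left (sign_mul_le_abs (Or.inl rfl) _) (by linarith [G.h_pos])

/-! ### Path connectedness -/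

/-- Two cells of two sheets are connected through any point at which they are pasted. -/
theorem joined_of_crossing {c d : Cell} {σ : Equiv.Perm (Fin 3)} (q : E3) (hq : q ∉ G.curves)
    (hc : q ∈ G.cellSet c) (hd : q ∈ G.cellSet d) (h : G.Crossing c d q σ) (i : Fin 3)
    {y z : G.Cover}
    (hy : ∀ x (hx : G.model x ∈ G.cellSet c), Joined (G.pt c x i hx) y)
    (hz : ∀ x (hx : G.model x ∈ G.cellSet d), Joined (G.pt d x (σ i) hx) z) : Joined y z := by
  have hc' : G.model (G.ofModel q hq) ∈ G.cellSet c := by simpa using hc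
  have hd' : G.model (G.ofModel q hq) ∈ G.cellSet d := by simpa using hd
  have e := G.pt_eq_of_crossing hc' hd' (by simpa using h) (rfl : σ i = σ i)
  exact (hy _ hc').symm.trans (e ▸ hz _ hd')

/-- Far away from the wedge and the disks, the outer cells of a sheet are connected with each
other. -/
theorem joined_outerPt_outerPt (j k : Fin 4) (i : Fin 3) :
    Joined (G.outerPt j i) (G.outerPt k i) := by
  have hh := G.h_pos
  have hR := G.one_lt_R
  have hpos := mul_pos G.s_pos hh
  have hsh : G.s * G.h < G.h := by nlinarith [G.s_lt_one]
  let q : ℝ → E3 := fun x => !₂[x, G.R + 1, G.R + 1]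
  have hR1 : |G.R + 1| = G.R + 1 := abs_of_pos (by linarith)
  have hout : ∀ x, x ≤ G.h → G.h + q x 0 < 2 * G.h * |q x 1| := by
    intro x hx
    simp [q, hR1]
    nlinarith
  have hcur : ∀ x, x ≤ G.h → q x ∉ G.curves := by
    rintro x hx (h | h | h)
    · exact absurd (G.edges_sub h).1.1 (not_le.2 (hout x hx))
    · have h2 : q x 1 ≤ 0 := h.1.2.2.1
      simp [q] at h2
      linarith
    · have h2 : q x 2 ≤ G.R := h.1.2.2.2
      simp [q] at h2
      linarith
  have step : ∀ (j k : Fin 4) (x : ℝ), x ≤ G.h → q x ∈ G.slab j → q x ∈ G.slab k →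
      G.Crossing (false, j) (false, k) (q x) 1 → Joined (G.outerPt j i) (G.outerPt k i) :=
    fun j k x hx hj hk h => G.joined_of_crossing (c := (false, j)) (d := (false, k)) (q x) (hcur x hx) ⟨Or.inl (hout x hx).le, hj⟩
      ⟨Or.inl (hout x hx).le, hk⟩ h i (fun x hx => G.joined_outerPt j x i hx)
      (fun x hx => G.joined_outerPt k x i hx)
  have s0 : Joined (G.outerPt 0 i) (G.outerPt 1 i) := by
    refine step 0 1 (-(G.s * G.h)) (by linarith) ?_ ?_ (.uncut1 _ _ ?_)
    · simp [slab, q]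
    · simp [slab, q]; exact hpos.le
    · rintro ⟨-, -, h, -⟩
      simp [q] at h
      linarith
  have s1 : Joined (G.outerPt 1 i) (G.outerPt 2 i) := by
    refine step 1 2 0 (by linarith) ?_ ?_ (.uncutMid _)
    · simp [slab, q]; exact hpos.le
    · simp [slab, q]; exact hpos.le
  have s2 : Joined (G.outerPt 2 i) (G.outerPt 3 i) := by
    refine step 2 3 (G.s * G.h) (by linarith) ?_ ?_ (.uncut2 _ _ ?_)
    · simp [slab, q]; exact hpos.le
    · simp [slab, q]
    · rintro ⟨-, -, -, h⟩
      simp [q] at h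
      linarith
  have all : ∀ j, Joined (G.outerPt 0 i) (G.outerPt j i) := by
    intro j
    fin_cases j
    · exact Joined.refl _
    · exact s0
    · exact s0.trans s1
    · exact (s0.trans s1).trans s2
  exact (all j).symm.trans (all k)

/-- On the long edges both inequalities that define the wedge are equalities, and the short edges lie
in the planes `x = ± h`; so a point whose first coordinate is some `slabX j` is not removed if one
of the equalities fails. -/
theorem notMem_curves_of_face {j : Fin 4} {q : E3} (h0 : q 0 = G.slabX j)
    (h : 2 * G.h * |q 1| ≠ G.h + q 0 ∨ 2 * G.h * |q 2| ≠ G.h - q 0) : q ∉ G.curves := by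
  refine G.notMem_curves_of_openSlab (G.mem_openSlab_of_eq h0) fun he => ?_
  have hj := G.slabX_bounds j
  rcases (G.edges_sub he).2 with h' | h' | h'
  · rcases h with h | h
    · exact h h'.1
    · exact h h'.2
  · linarith
  · linarith

/-- Every inner cell of a sheet is connected, through an uncut face of the wedge, with the outer
cell of the same sheet. -/
theorem joined_inner_outerPt (j : Fin 4) (x : G.Base) (i : Fin 3)
    (hx : G.model x ∈ G.cellSet (true, j)) : Joined (G.pt _ x i hx) (G.outerPt j i) := by
  have hh := G.h_pos
  have hj := G.slabX_bounds j
  refine (G.joined_innerCenter j x i hx).trans ?_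
  have key : ∀ q : E3, q 0 = G.slabX j → q ∉ G.curves → q ∈ G.wedge → q ∈ G.outside →
      G.Crossing (true, j) (false, j) q 1 → _ :=
    fun q h0 hq hw ho h =>
    G.joined_of_crossing (σ := 1) (c := (true, j)) (d := (false, j)) q hq
      ⟨hw, (G.isCore_slab j).1 (G.mem_openSlab_of_eq h0)⟩
      ⟨ho, (G.isCore_slab j).1 (G.mem_openSlab_of_eq h0)⟩ h i
      (fun x hx => G.joined_innerCenter j x i hx) (fun x hx => G.joined_outerPt j x i hx)
  have hcase : (j = 0 ∨ j = 1) ∨ (j = 2 ∨ j = 3) := by omega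
  rcases hcase with hc | hc
  · -- a point of the top face
    let q : E3 := !₂[G.slabX j, 0, (G.h - G.slabX j) / (2 * G.h)]
    have e : 2 * G.h * |q 2| = G.h - q 0 := by
      simp [q]
      rw [abs_of_pos (div_pos (by linarith) (by linarith))]
      field_simp
    have e1 : 2 * G.h * |q 1| < G.h + q 0 := by simp [q]; linarith
    have hw : q ∈ G.wedge := ⟨e1.le, e.le⟩
    refine key q (by simp [q]) (G.notMem_curves_of_face (j := j) (by simp [q]) (Or.inl e1.ne)) hw
      (Or.inr e.ge) (.uncutLeft j hc q fun h => e1.ne (G.mem_front_or_back.1 h).2)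
  · -- a point of the back face
    let q : E3 := !₂[G.slabX j, (G.h + G.slabX j) / (2 * G.h), 0]
    have e : 2 * G.h * |q 1| = G.h + q 0 := by
      simp [q]
      rw [abs_of_pos (div_pos (by linarith) (by linarith))]
      field_simp
    have e1 : 2 * G.h * |q 2| < G.h - q 0 := by simp [q]; linarith
    have hw : q ∈ G.wedge := ⟨e.le, e1.le⟩
    refine key q (by simp [q]) (G.notMem_curves_of_face (j := j) (by simp [q]) (Or.inr e1.ne)) hw
      (Or.inl e.ge) (.uncutRight j hc q fun h => e1.ne (G.mem_top_or_bottom.1 h).2)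

/-- Leaving the wedge through its back face permutes the sheets cyclically. -/
theorem joined_outerPt_cyc (i : Fin 3) : Joined (G.outerPt 1 i) (G.outerPt 1 (cyc i)) := by
  have hh := G.h_pos
  have hj := G.slabX_bounds 1
  let q : E3 := !₂[G.slabX 1, (G.h + G.slabX 1) / (2 * G.h), 0]
  have e : 2 * G.h * q 1 = G.h + q 0 := by
    simp [q]
    field_simp
  have e' : 2 * G.h * |q 1| = G.h + q 0 := by
    rw [abs_of_nonneg, e]
    simp [q]
    exact div_nonneg (by linarith) (by linarith)
  have e1 : 2 * G.h * |q 2| < G.h - q 0 := by simp [q]; linarith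
  have hw : q ∈ G.wedge := ⟨e'.le, e1.le⟩
  have hs : q ∈ G.slab 1 := (G.isCore_slab 1).1 (G.mem_openSlab_of_eq (by simp [q]))
  exact G.joined_of_crossing (σ := cyc) (c := (true, 1)) (d := (false, 1)) q
    (G.notMem_curves_of_face (j := 1) (by simp [q]) (Or.inr e1.ne))
    ⟨hw, hs⟩ ⟨Or.inl e'.ge, hs⟩ (.back 1 (Or.inr rfl) q ⟨hw, e⟩) i
    (fun x hx => G.joined_inner_outerPt 1 x i hx) (fun x hx => G.joined_outerPt 1 x _ hx)

instance pathConnectedSpace_cover : PathConnectedSpace G.Cover := by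
  have h1 : ∀ i, Joined (G.outerPt 1 0) (G.outerPt 1 i) := by
    intro i
    have a := G.joined_outerPt_cyc 0
    have b := G.joined_outerPt_cyc 1
    fin_cases i
    · exact Joined.refl _
    · exact a
    · exact a.trans b
  have h2 : ∀ y, Joined y (G.outerPt 1 0) := by
    intro y
    obtain ⟨⟨b, j⟩, x, i, hx, rfl⟩ := G.exists_eq_pt y
    have : Joined (G.pt (b, j) x i hx) (G.outerPt j i) := by
      cases b
      · exact G.joined_outerPt j x i hx
      · exact G.joined_inner_outerPt j x i hx
    exact (this.trans (G.joined_outerPt_outerPt j 1 i)).trans (h1 i).symm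
  exact ⟨⟨G.outerPt 1 0⟩, fun y z => (h2 y).trans (h2 z).symm⟩

/-! ### Deck transformations -/

/-- Only on the first sheet the lift of the loop `a` is closed, and a deck transformation maps
closed lifts to closed lifts; so it fixes a point of the connected cover. -/
theorem eq_refl_of_isDeckTransformation (ψ : G.Cover ≃ₜ G.Cover)
    (hψ : IsDeckTransformation G.proj ψ) : ψ = Homeomorph.refl G.Cover := by
  have hcov := G.isCoveringMap_proj
  obtain ⟨Γ, hΓ, h0, h1⟩ := G.exists_lift_loopA 0
  -- The image of the first sheet's point lies over the base point, hence on one of the sheets.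
  have hfib : ∃ k, ψ (G.sheetPoint 0) = G.sheetPoint k := by
    have hinj : Function.Injective
        (fun k => (⟨G.sheetPoint k, rfl⟩ : G.proj ⁻¹' {G.basePoint})) :=
      fun _ _ h => G.sheetPoint_injective (Subtype.ext_iff.1 h)
    have : Finite (G.proj ⁻¹' {G.basePoint}) :=
      Nat.finite_of_card_ne_zero (by rw [G.card_fiber]; norm_num)
    have hsurj := (Function.Injective.bijective_of_nat_card_le hinj
      (by rw [G.card_fiber]; simp)).2
    obtain ⟨k, hk⟩ := hsurj ⟨ψ (G.sheetPoint 0), hψ _⟩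
    exact ⟨k, (Subtype.ext_iff.1 hk).symm⟩
  obtain ⟨k, hk⟩ := hfib
  obtain ⟨Γ', hΓ', h0', h1'⟩ := G.exists_lift_loopA k
  have he : ψ ∘ Γ = Γ' := hcov.eq_of_comp_eq (ψ.continuous.comp Γ.continuous) Γ'.continuous
    (funext fun t => (hψ _).trans ((hΓ t).trans (hΓ' t).symm)) 0
    (by rw [Function.comp_apply, h0, hk, h0'])
  have hk0 : tr k = k := by
    apply G.sheetPoint_injective
    rw [← h1', ← he, Function.comp_apply, h1, ← hk]
    rfl
  have hk' : k = 0 := by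
    revert hk0
    fin_cases k <;> decide
  subst hk'
  have := hcov.eq_of_comp_eq ψ.continuous continuous_id (funext hψ) (G.sheetPoint 0) hk
  exact Homeomorph.ext fun y => congrFun this y

end WedgeGeometry

end

theorem mainTheorem8 (G : WedgeGeometry) :
    -- the construction gives a path connected cover of degree three
    (IsCoveringMap G.proj ∧ (∀ x : G.Base, Nat.card (G.proj ⁻¹' {x}) = 3) ∧
      PathConnectedSpace G.Cover) ∧
    -- it is not normal
    ¬ IsNormalCover G.proj ∧
    -- the identity is its only deck transformation
    (∀ ψ : G.Cover ≃ₜ G.Cover, IsDeckTransformation G.proj ψ → ψ = Homeomorph.refl G.Cover) ∧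
    -- the lift of the loop `a` from sheet `k` ends on sheet `tr k`; it is closed only on sheet 1
    (∀ k : Fin 3, ∃ Γ : C(unitInterval, G.Cover),
      (∀ t, G.proj (Γ t) = G.loopA t) ∧ Γ 0 = G.sheetPoint k ∧
      Γ 1 = G.sheetPoint (WedgeGeometry.tr k) ∧ (Γ 1 = Γ 0 ↔ k = 0) ∧
      ∀ Γ' : C(unitInterval, G.Cover),
        (∀ t, G.proj (Γ' t) = G.loopA t) → Γ' 0 = G.sheetPoint k → Γ' = Γ) := by
  refine ⟨⟨G.isCoveringMap_proj, G.card_fiber, inferInstance⟩, fun hn => ?_,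
    G.eq_refl_of_isDeckTransformation, fun k => ?_⟩
  · obtain ⟨ψ, hψ, h⟩ := hn (G.sheetPoint 0) (G.sheetPoint 1) rfl
    rw [G.eq_refl_of_isDeckTransformation ψ hψ] at h
    exact absurd (G.sheetPoint_injective h) (by decide)
  · obtain ⟨Γ, hΓ, h0, h1⟩ := G.exists_lift_loopA k
    refine ⟨Γ, hΓ, h0, h1, ?_, fun Γ' hΓ' h0' => ?_⟩
    · rw [h0, h1, G.sheetPoint_injective.eq_iff]
      fin_cases k <;> decide
    · exact DFunLike.coe_injective (G.isCoveringMap_proj.eq_of_comp_eq Γ'.continuous Γ.continuous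
        (funext fun t => (hΓ' t).trans (hΓ t).symm) 0 (h0'.trans h0.symm))
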